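/- Let $(\Omega,\mathbb F,(\mathcal F_t)_{t\le T},\mathbb P)$, $T<\infty$, be a filtered probability space satisfying the usual conditions, and let $S$ be an $\mathbb R^d$-valued semimartingale on it. For $x>0$ let $\mathcal X(x)$ be the set of nonnegative processes $X=X_0+\int H\,dS$ with $X_0\in[0,x]$ constant and $H$ predictable and $S$-integrable, and let $\mathcal Y$ be the set of processes $Y\ge 0$ with $Y_0=1$ such that $XY$ is a $\mathbb P$-supermartingale for every $X\in\mathcal X(1)$. Let $U:(0,\infty)\to\mathbb R$ be strictly increasing, strictly concave and continuously differentiable with $U'(0+)=\infty$, $U'(+\infty)=0$ and $U(0+)=0$; put $U^{-1}(0)=0$ and $U^{-1}=+\infty$ on $[\lim_{x\to\infty}U(x),\infty)$, and let $V(y)=\sup_{x>0}(U(x)-xy)$. Assume that there is $Y\in\mathcal Y$ with $Y_T>0$ a.s. and $\mathbb E[V(\beta Y_T)]<\infty$ for all $\beta>0$. For $Z,X\in L^0(\mathbb P)$ (real random variables modulo a.s. equality) define $$I(Z)=\inf_{Y\in\mathcal Y}\mathbb E\big[|Z|V(Y_T/|Z|)\big],\qquad J(X)=\sup_{Y\in\mathcal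 Y}\mathbb E\big[Y_TU^{-1}(|X|)\big],$$ where $|z|V(y/|z|):=0$ for $z=0$ and $0\cdot\infty:=0$. For $F\in\{I,J\}$ let $L_F=\{W\in L^0:F(\alpha W)<\infty\text{ for some }\alpha>0\}$ and $E_F=\{W\in L^0:F(\alpha W)<\infty\text{ for all }\alpha>0\}$, with the Luxemburg norm $|W|_F^l=\inf\{\beta>0:F(W/\beta)\le 1\}$ and the equivalent Amemiya norm $|W|_F^a=\inf_{k>0}\big(\tfrac1k+\tfrac1kF(kW)\big)$. Then $ZX$ is integrable for all $Z\in L_I$, $X\in L_J$, and: 1. The map $X\mapsto\big(Z\mapsto\mathbb E[ZX]\big)$ is a linear isometric bijection of $(L_J,|\cdot|_J^l)$ onto the topological dual of $(E_I,|\cdot|_I^a)$ with its dual norm. 2. For every $X\in L_J$ the functional $l_X=\mathbb E[\,\cdot\,X]$ on $L_I$ is continuous and $$I^*(l_X):=\sup_{Z\in L_I}\{l_X(Z)-I(Z)\}=J(X).$$ 3. If $E_I=L_I$, then for every $Z\in L_I$ the functional $l_Z=\mathbb E[\,\cdot\,Z]$ on $L_J$ is continuous and $$J^*(l_Z):=\sup_{X\in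 L_J}\{l_Z(X)-J(X)\}=I(Z).$$ -/

import Mathlib

open MeasureTheory ProbabilityTheory Filter Topology
open scoped NNReal ENNReal

noncomputable section

/-! ## Modulars, modular spaces, Luxemburg and Amemiya norms -/

/-- A functional `F : S → [0, ∞]` with the properties of a convex modular that make the modular
space a vector space and the Luxemburg and Amemiya functionals norms on it. -/
structure ConvexModular (S : Type*) [AddCommGroup S] [Module ℝ S] where
  toFun : S → ℝ≥0∞
  map_zero' : toFun 0 = 0
  map_neg' : ∀ s, toFun (-s) = toFun s
  convex' : ∀ (a b : ℝ), 0 ≤ a → 0 ≤ b → a + b = 1 → ∀ s t,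
    toFun (a • s + b • t) ≤ ENNReal.ofReal a * toFun s + ENNReal.ofReal b * toFun t
  definite' : ∀ s, (∀ ξ : ℝ, 0 < ξ → toFun (ξ • s) = 0) → s = 0

namespace ConvexModular

variable {S : Type*} [AddCommGroup S] [Module ℝ S]

instance : CoeFun (ConvexModular S) (fun _ => S → ℝ≥0∞) := ⟨ConvexModular.toFun⟩

variable (F : ConvexModular S)

lemma map_smul_le {c : ℝ} (h0 : 0 ≤ c) (h1 : c ≤ 1) (s : S) :
    F (c • s) ≤ ENNReal.ofReal c * F s := by
  have := F.convex' c (1 - c) h0 (by linarith) (by ring) s 0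
  simpa [F.map_zero'] using this

lemma map_smul_mono {a b : ℝ} (ha : 0 ≤ a) (hab : a ≤ b) (s : S) : F (a • s) ≤ F (b • s) := by
  rcases eq_or_lt_of_le (ha.trans hab) with hb | hb
  · have : a = b := le_antisymm hab (hb ▸ ha)
    rw [this]
  have h := F.map_smul_le (c := a / b) (by positivity) ((div_le_one hb).2 hab) (b • s)
  rw [smul_smul, div_mul_cancel₀ _ hb.ne'] at h
  refine h.trans ?_
  calc ENNReal.ofReal (a / b) * F (b • s) ≤ 1 * F (b • s) := by
        gcongr
        exact ENNReal.ofReal_le_one.2 ((div_le_one hb).2 hab)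
    _ = _ := one_mul _

lemma map_abs_smul (c : ℝ) (s : S) : F (|c| • s) = F (c • s) := by
  rcases abs_cases c with ⟨h, _⟩ | ⟨h, _⟩
  · rw [h]
  · rw [h, neg_smul, F.map_neg']

/-- Weighted convexity in the form used for both norms. -/
lemma map_add_le {p q : ℝ} (hp : 0 < p) (hq : 0 < q) (s t : S) :
    F ((p + q)⁻¹ • (s + t)) ≤
      ENNReal.ofReal (p / (p + q)) * F (p⁻¹ • s) + ENNReal.ofReal (q / (p + q)) * F (q⁻¹ • t) := by
  have hpq : 0 < p + q := by positivity
  have h := F.convex' (p / (p + q)) (q / (p + q)) (by positivity) (by positivity)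
    (by field_simp) (p⁻¹ • s) (q⁻¹ • t)
  have e1 : p / (p + q) * p⁻¹ = (p + q)⁻¹ := by field_simp
  have e2 : q / (p + q) * q⁻¹ = (p + q)⁻¹ := by field_simp
  rwa [smul_smul, smul_smul, e1, e2, ← smul_add] at h

/-- The modular space `L_F = {s : F (α s) < ∞ for some α > 0}`. -/
def space : Submodule ℝ S where
  carrier := {s | ∃ α : ℝ, 0 < α ∧ F (α • s) < ∞}
  zero_mem' := ⟨1, one_pos, by simp [F.map_zero']⟩
  add_mem' := by
    rintro s t ⟨a, ha, hs⟩ ⟨b, hb, ht⟩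
    refine ⟨(a⁻¹ + b⁻¹)⁻¹, by positivity, ?_⟩
    refine (F.map_add_le (inv_pos.2 ha) (inv_pos.2 hb) s t).trans_lt ?_
    rw [inv_inv, inv_inv]
    exact ENNReal.add_lt_top.2 ⟨ENNReal.mul_lt_top ENNReal.ofReal_lt_top hs,
      ENNReal.mul_lt_top ENNReal.ofReal_lt_top ht⟩
  smul_mem' := by
    rintro c s ⟨a, ha, hs⟩
    refine ⟨a / (|c| + 1), by positivity, ?_⟩
    rw [smul_smul, ← F.map_abs_smul]
    refine (F.map_smul_mono (abs_nonneg _) ?_ s).trans_lt hs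
    rw [abs_mul, abs_of_pos (by positivity : 0 < a / (|c| + 1)), div_mul_eq_mul_div,
      div_le_iff₀ (by positivity)]
    nlinarith [abs_nonneg c]

/-- The Luxemburg functional `|s|^l = inf {β > 0 : F (s / β) ≤ 1}`. -/
def luxemburg (s : S) : ℝ := sInf {β : ℝ | 0 < β ∧ F (β⁻¹ • s) ≤ 1}

/-- The Amemiya functional `|s|^a = inf {1 / k + F (k s) / k : k > 0}`; it is finite on `L_F`. -/
def amemiya (s : S) : ℝ :=
  (⨅ (k : ℝ) (_ : 0 < k), (1 / ENNReal.ofReal k + F (k • s) / ENNReal.ofReal k)).toReal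

/-! ### The Luxemburg functional is a norm -/

lemma luxemburg_bddBelow (s : S) : BddBelow {β : ℝ | 0 < β ∧ F (β⁻¹ • s) ≤ 1} :=
  ⟨0, fun _ h => h.1.le⟩

lemma luxemburg_nonneg (s : S) : 0 ≤ F.luxemburg s := Real.sInf_nonneg fun _ h => h.1.le

lemma luxemburg_nonempty {s : S} (hs : s ∈ F.space) :
    {β : ℝ | 0 < β ∧ F (β⁻¹ • s) ≤ 1}.Nonempty := by
  obtain ⟨a, ha, hs⟩ := hs
  set M := (F (a • s)).toReal with hM
  have hM0 : 0 ≤ M := ENNReal.toReal_nonneg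
  refine ⟨a⁻¹ * (M + 1), by positivity, ?_⟩
  have e : (a⁻¹ * (M + 1))⁻¹ • s = (M + 1)⁻¹ • (a • s) := by
    rw [smul_smul, mul_inv, inv_inv, mul_comm]
  rw [e]
  refine (F.map_smul_le (by positivity) (inv_le_one_of_one_le₀ (by linarith)) _).trans ?_
  rw [← ENNReal.ofReal_toReal hs.ne, ← ENNReal.ofReal_mul (by positivity)]
  refine ENNReal.ofReal_le_one.2 ?_
  rw [← hM, inv_mul_le_iff₀ (by positivity)]
  linarith

lemma luxemburg_add_le {s t : S} (hs : s ∈ F.space) (ht : t ∈ F.space) :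
    F.luxemburg (s + t) ≤ F.luxemburg s + F.luxemburg t := by
  have key : ∀ p ∈ {β : ℝ | 0 < β ∧ F (β⁻¹ • s) ≤ 1}, ∀ q ∈ {β : ℝ | 0 < β ∧ F (β⁻¹ • t) ≤ 1},
      F.luxemburg (s + t) ≤ p + q := by
    rintro p ⟨hp, hps⟩ q ⟨hq, hqt⟩
    refine csInf_le (F.luxemburg_bddBelow _) ⟨by positivity, (F.map_add_le hp hq s t).trans ?_⟩
    calc _ ≤ ENNReal.ofReal (p / (p + q)) * 1 + ENNReal.ofReal (q / (p + q)) * 1 := by gcongr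
      _ = 1 := by
        rw [mul_one, mul_one, ← ENNReal.ofReal_add (by positivity) (by positivity), ← add_div,
          div_self (by positivity), ENNReal.ofReal_one]
  have h1 : ∀ p ∈ {β : ℝ | 0 < β ∧ F (β⁻¹ • s) ≤ 1},
      F.luxemburg (s + t) - p ≤ F.luxemburg t := fun p hp =>
    le_csInf (F.luxemburg_nonempty ht) fun q hq => by linarith [key p hp q hq]
  have h2 : F.luxemburg (s + t) - F.luxemburg t ≤ F.luxemburg s :=
    le_csInf (F.luxemburg_nonempty hs) fun p hp => by linarith [h1 p hp]
  linarith

lemma luxemburg_smul_le {s : S} (hs : s ∈ F.space) {c : ℝ} (hc : c ≠ 0) :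
    F.luxemburg (c • s) ≤ |c| * F.luxemburg s := by
  have hc' : 0 < |c| := abs_pos.2 hc
  rw [← div_le_iff₀' hc']
  refine le_csInf (F.luxemburg_nonempty hs) ?_
  rintro p ⟨hp, hps⟩
  rw [div_le_iff₀' hc']
  refine csInf_le (F.luxemburg_bddBelow _) ⟨by positivity, ?_⟩
  rwa [smul_smul, ← F.map_abs_smul, abs_mul, abs_inv, abs_mul, abs_abs, mul_inv, mul_right_comm,
    inv_mul_cancel₀ hc'.ne', one_mul, abs_of_pos hp]

lemma luxemburg_zero : F.luxemburg 0 = 0 := by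
  refine le_antisymm (le_of_forall_pos_le_add fun ε hε => ?_) (F.luxemburg_nonneg _)
  rw [zero_add]
  exact csInf_le (F.luxemburg_bddBelow _) ⟨hε, by simp [F.map_zero']⟩

lemma luxemburg_smul {s : S} (hs : s ∈ F.space) (c : ℝ) :
    F.luxemburg (c • s) = |c| * F.luxemburg s := by
  rcases eq_or_ne c 0 with rfl | hc
  · simp [F.luxemburg_zero]
  refine le_antisymm (F.luxemburg_smul_le hs hc) ?_
  have h := F.luxemburg_smul_le (F.space.smul_mem c hs) (inv_ne_zero hc)
  rw [smul_smul, inv_mul_cancel₀ hc, one_smul, abs_inv] at h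
  rwa [← le_inv_mul_iff₀ (abs_pos.2 hc)]

lemma luxemburg_eq_zero {s : S} (hs : s ∈ F.space) (h : F.luxemburg s = 0) : s = 0 := by
  refine F.definite' s fun ξ hξ => ?_
  refine le_antisymm (le_of_forall_pos_le_add fun ε hε => ?_) bot_le
  rw [zero_add]
  obtain ⟨δ, hδ0, hδ⟩ : ∃ δ : ℝ, 0 < δ ∧ ENNReal.ofReal δ ≤ ε := by
    rcases eq_or_ne ε ∞ with rfl | hε'
    · exact ⟨1, one_pos, le_top⟩
    · exact ⟨ε.toReal, ENNReal.toReal_pos hε.ne' hε', (ENNReal.ofReal_toReal hε').le⟩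
  have hlt : F.luxemburg s < min 1 δ / ξ := by rw [h]; positivity
  obtain ⟨β, ⟨hβ, hF⟩, hβlt⟩ := (csInf_lt_iff (F.luxemburg_bddBelow s) (F.luxemburg_nonempty hs)).1 hlt
  rw [lt_div_iff₀ hξ] at hβlt
  have h1 : ξ * β ≤ 1 := by linarith [min_le_left 1 δ]
  have h2 : ξ * β ≤ δ := by linarith [min_le_right 1 δ]
  have e : ξ • s = (ξ * β) • (β⁻¹ • s) := by
    rw [smul_smul, mul_assoc, mul_inv_cancel₀ hβ.ne', mul_one]
  rw [e]
  calc _ ≤ ENNReal.ofReal (ξ * β) * F (β⁻¹ • s) := F.map_smul_le (by positivity) h1 _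
    _ ≤ ENNReal.ofReal δ * 1 := by gcongr
    _ ≤ ε := by rwa [mul_one]

/-! ### The Amemiya functional is a norm -/

/-- The Amemiya functional before taking the real part. -/
def amemiyaE (s : S) : ℝ≥0∞ :=
  ⨅ (k : ℝ) (_ : 0 < k), (1 / ENNReal.ofReal k + F (k • s) / ENNReal.ofReal k)

lemma amemiyaE_le (s : S) {k : ℝ} (hk : 0 < k) :
    F.amemiyaE s ≤ 1 / ENNReal.ofReal k + F (k • s) / ENNReal.ofReal k := iInf₂_le k hk

lemma amemiyaE_ne_top {s : S} (hs : s ∈ F.space) : F.amemiyaE s ≠ ∞ := by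
  obtain ⟨a, ha, hs⟩ := hs
  have h0 : ENNReal.ofReal a ≠ 0 := (ENNReal.ofReal_pos.2 ha).ne'
  exact ((F.amemiyaE_le s ha).trans_lt (ENNReal.add_lt_top.2
    ⟨ENNReal.div_lt_top ENNReal.one_ne_top h0, ENNReal.div_lt_top hs.ne h0⟩)).ne

lemma amemiyaE_add_le (s t : S) : F.amemiyaE (s + t) ≤ F.amemiyaE s + F.amemiyaE t := by
  refine ENNReal.le_iInf₂_add_iInf₂ fun a ha b hb => ?_
  have hc : 0 < a⁻¹ + b⁻¹ := by positivity
  have ea : ENNReal.ofReal a ≠ 0 := (ENNReal.ofReal_pos.2 ha).ne'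
  refine (F.amemiyaE_le (s + t) (inv_pos.2 hc)).trans ?_
  have h := F.map_add_le (inv_pos.2 ha) (inv_pos.2 hb) s t
  rw [inv_inv, inv_inv] at h
  simp only [div_eq_mul_inv, one_mul, ← ENNReal.ofReal_inv_of_pos ha,
    ← ENNReal.ofReal_inv_of_pos hb, ← ENNReal.ofReal_inv_of_pos (inv_pos.2 hc), inv_inv] at h ⊢
  calc _ ≤ ENNReal.ofReal (a⁻¹ + b⁻¹) +
        (ENNReal.ofReal (a⁻¹ * (a⁻¹ + b⁻¹)⁻¹) * F (a • s) +
          ENNReal.ofReal (b⁻¹ * (a⁻¹ + b⁻¹)⁻¹) * F (b • t)) * ENNReal.ofReal (a⁻¹ + b⁻¹) := by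
        gcongr
    _ = _ := by
        rw [add_mul, mul_right_comm, mul_right_comm (ENNReal.ofReal (b⁻¹ * _)),
          ← ENNReal.ofReal_mul (by positivity), ← ENNReal.ofReal_mul (by positivity),
          mul_assoc, mul_assoc, inv_mul_cancel₀ hc.ne', mul_one, mul_one,
          ENNReal.ofReal_add (by positivity) (by positivity)]
        ring

lemma amemiyaE_smul_le (s : S) {c : ℝ} (hc : c ≠ 0) :
    F.amemiyaE (c • s) ≤ ENNReal.ofReal |c| * F.amemiyaE s := by
  have hc' : 0 < |c| := abs_pos.2 hc
  have h0 : ENNReal.ofReal |c| ≠ 0 := (ENNReal.ofReal_pos.2 hc').ne'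
  unfold amemiyaE
  rw [ENNReal.mul_iInf_of_ne h0 ENNReal.ofReal_ne_top]
  refine le_iInf fun k => ?_
  by_cases hk : 0 < k
  · simp only [hk, iInf_pos]
    refine (F.amemiyaE_le (c • s) (div_pos hk hc')).trans (le_of_eq ?_)
    rw [smul_smul, ← F.map_abs_smul, abs_mul, abs_of_pos (div_pos hk hc'),
      div_mul_cancel₀ _ hc'.ne']
    simp only [div_eq_mul_inv, one_mul, ← ENNReal.ofReal_inv_of_pos (mul_pos hk (inv_pos.2 hc')),
      ← ENNReal.ofReal_inv_of_pos hk]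
    rw [mul_inv, inv_inv, mul_comm k⁻¹, ENNReal.ofReal_mul hc'.le]
    ring
  · simp [hk, ENNReal.mul_top h0]

lemma amemiyaE_zero : F.amemiyaE 0 = 0 := by
  refine le_antisymm (le_of_forall_pos_le_add fun ε hε => ?_) bot_le
  rw [zero_add]
  rcases eq_or_ne ε ∞ with rfl | hε'
  · exact le_top
  have hpos : 0 < ε.toReal := ENNReal.toReal_pos hε.ne' hε'
  refine (F.amemiyaE_le 0 (inv_pos.2 hpos)).trans (le_of_eq ?_)
  rw [smul_zero, F.map_zero', ENNReal.zero_div, add_zero, one_div,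
    ← ENNReal.ofReal_inv_of_pos (inv_pos.2 hpos), inv_inv, ENNReal.ofReal_toReal hε']

lemma amemiyaE_smul (s : S) (c : ℝ) : F.amemiyaE (c • s) = ENNReal.ofReal |c| * F.amemiyaE s := by
  rcases eq_or_ne c 0 with rfl | hc
  · simp [F.amemiyaE_zero]
  have hc' : 0 < |c| := abs_pos.2 hc
  refine le_antisymm (F.amemiyaE_smul_le s hc) ?_
  have h := F.amemiyaE_smul_le (c • s) (inv_ne_zero hc)
  rw [smul_smul, inv_mul_cancel₀ hc, one_smul, abs_inv] at h
  calc _ ≤ ENNReal.ofReal |c| * (ENNReal.ofReal |c|⁻¹ * F.amemiyaE (c • s)) := by gcongr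
    _ = _ := by
      rw [← mul_assoc, ← ENNReal.ofReal_mul hc'.le, mul_inv_cancel₀ hc'.ne', ENNReal.ofReal_one,
        one_mul]

lemma amemiyaE_eq_zero {s : S} (h : F.amemiyaE s = 0) : s = 0 := by
  refine F.definite' s fun ξ hξ => ?_
  refine le_antisymm (le_of_forall_pos_le_add fun ε hε => ?_) bot_le
  rw [zero_add]
  have hξ0 : ENNReal.ofReal ξ ≠ 0 := (ENNReal.ofReal_pos.2 hξ).ne'
  have hlt : F.amemiyaE s < min (1 / ENNReal.ofReal ξ) (ε / ENNReal.ofReal ξ) := by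
    rw [h]
    exact lt_min (ENNReal.div_pos one_ne_zero ENNReal.ofReal_ne_top)
      (ENNReal.div_pos hε.ne' ENNReal.ofReal_ne_top)
  simp only [amemiyaE, iInf_lt_iff] at hlt
  obtain ⟨k, hk, hlt⟩ := hlt
  have h1 := (le_self_add.trans_lt hlt).trans_le (min_le_left _ _)
  have h2 := (le_add_self.trans_lt hlt).trans_le (min_le_right _ _)
  have hξk : ξ ≤ k := by
    by_contra hcon
    push Not at hcon
    refine absurd h1 (not_lt.2 ?_)
    gcongr
  have e : ξ • s = (ξ / k) • (k • s) := by rw [smul_smul, div_mul_cancel₀ _ hk.ne']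
  rw [e]
  refine (F.map_smul_le (by positivity) ((div_le_one hk).2 hξk) _).trans ?_
  rw [ENNReal.ofReal_div_of_pos hk, div_eq_mul_inv, mul_assoc, mul_comm _ (F (k • s)),
    ← div_eq_mul_inv]
  calc _ ≤ ENNReal.ofReal ξ * (ε / ENNReal.ofReal ξ) := by gcongr
    _ = ε := ENNReal.mul_div_cancel hξ0 ENNReal.ofReal_ne_top

/-! ### The modular space with each of the two norms -/

/-- The space `L_F` with the Luxemburg norm. -/
def Lux : Type _ := F.space

/-- The space `L_F` with the Amemiya norm. -/
def Ame : Type _ := F.space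

instance : AddCommGroup F.Lux := inferInstanceAs (AddCommGroup F.space)
instance : Module ℝ F.Lux := inferInstanceAs (Module ℝ F.space)
instance : AddCommGroup F.Ame := inferInstanceAs (AddCommGroup F.space)
instance : Module ℝ F.Ame := inferInstanceAs (Module ℝ F.space)

variable {F} in
/-- The underlying element of `S`. -/
def Lux.val (s : F.Lux) : S := Subtype.val (p := (· ∈ F.space)) s

variable {F} in
/-- The underlying element of `S`. -/
def Ame.val (s : F.Ame) : S := Subtype.val (p := (· ∈ F.space)) s

variable {F} in
lemma Lux.mem (s : F.Lux) : s.val ∈ F.space := Subtype.prop (p := (· ∈ F.space)) s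

variable {F} in
lemma Ame.mem (s : F.Ame) : s.val ∈ F.space := Subtype.prop (p := (· ∈ F.space)) s

instance : Norm F.Lux := ⟨fun s => F.luxemburg s.val⟩
instance : Norm F.Ame := ⟨fun s => F.amemiya s.val⟩

lemma luxCore : NormedSpace.Core ℝ F.Lux where
  norm_nonneg s := F.luxemburg_nonneg s.val
  norm_smul c s := F.luxemburg_smul s.mem c
  norm_triangle s t := F.luxemburg_add_le s.mem t.mem
  norm_eq_zero_iff s :=
    ⟨fun h => Subtype.ext (F.luxemburg_eq_zero s.mem h),
      fun h => by subst h; exact F.luxemburg_zero⟩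

lemma ameCore : NormedSpace.Core ℝ F.Ame where
  norm_nonneg _ := ENNReal.toReal_nonneg
  norm_smul c s := by
    change (F.amemiyaE (c • s.val)).toReal = |c| * (F.amemiyaE s.val).toReal
    rw [F.amemiyaE_smul, ENNReal.toReal_mul, ENNReal.toReal_ofReal (abs_nonneg c)]
  norm_triangle s t := by
    change (F.amemiyaE (s.val + t.val)).toReal ≤
      (F.amemiyaE s.val).toReal + (F.amemiyaE t.val).toReal
    have hs := F.amemiyaE_ne_top s.mem
    have ht := F.amemiyaE_ne_top t.mem
    rw [← ENNReal.toReal_add hs ht]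
    exact ENNReal.toReal_mono (ENNReal.add_ne_top.2 ⟨hs, ht⟩) (F.amemiyaE_add_le _ _)
  norm_eq_zero_iff s := by
    constructor
    · intro h
      have h' : (F.amemiyaE s.val).toReal = 0 := h
      rw [ENNReal.toReal_eq_zero_iff] at h'
      exact Subtype.ext (F.amemiyaE_eq_zero
        (h'.resolve_right (F.amemiyaE_ne_top s.mem)))
    · rintro rfl
      change (F.amemiyaE 0).toReal = 0
      rw [F.amemiyaE_zero, ENNReal.toReal_zero]

instance : NormedAddCommGroup F.Lux := NormedAddCommGroup.ofCore F.luxCore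
instance : NormedSpace ℝ F.Lux := NormedSpace.ofCore F.luxCore
instance : NormedAddCommGroup F.Ame := NormedAddCommGroup.ofCore F.ameCore
instance : NormedSpace ℝ F.Ame := NormedSpace.ofCore F.ameCore

/-- The space of finite elements `E_F = {s : F (α s) < ∞ for all α > 0}`, as a subspace of `L_F`
with the Amemiya norm. -/
def finiteElements : Submodule ℝ F.Ame where
  carrier := {s | ∀ α : ℝ, 0 < α → F (α • s.val) < ∞}
  zero_mem' := fun α _ => by
    change F (α • (0 : S)) < ∞
    simp [F.map_zero']
  add_mem' := by
    intro s t hs ht α hα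
    have h := F.map_add_le (p := (2 * α)⁻¹) (q := (2 * α)⁻¹) (by positivity) (by positivity)
      s.val t.val
    have e : ((2 * α)⁻¹ + (2 * α)⁻¹)⁻¹ = α := by field_simp; norm_num
    rw [e, inv_inv] at h
    exact h.trans_lt (ENNReal.add_lt_top.2
      ⟨ENNReal.mul_lt_top ENNReal.ofReal_lt_top (hs _ (by positivity)),
        ENNReal.mul_lt_top ENNReal.ofReal_lt_top (ht _ (by positivity))⟩)
  smul_mem' := by
    intro c s hs α hα
    change F (α • (c • s.val)) < ∞
    rw [smul_smul, ← F.map_abs_smul]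
    refine (F.map_smul_mono (abs_nonneg _) ?_ s.val).trans_lt (hs (α * (|c| + 1)) (by positivity))
    rw [abs_mul, abs_of_pos hα]
    nlinarith [abs_nonneg c]

/-- The convex conjugate `F^*(l) = sup_{s ∈ L_F} (l(s) - F(s))` of `F` at a functional `l` in the
topological dual of `L_F` (Amemiya norm). -/
def conjAme (l : StrongDual ℝ F.Ame) : EReal := ⨆ s : F.Ame, ((l s : ℝ) : EReal) - (F s.val : EReal)

/-- The convex conjugate `F^*(l) = sup_{s ∈ L_F} (l(s) - F(s))` of `F` at a functional `l` in the
topological dual of `L_F` (Luxemburg norm). -/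
def conjLux (l : StrongDual ℝ F.Lux) : EReal := ⨆ s : F.Lux, ((l s : ℝ) : EReal) - (F s.val : EReal)

end ConvexModular

/-! ## Stochastic integration on the time interval `[0, T]` -/

section StochasticIntegration

variable {Ω : Type*} {m : MeasurableSpace Ω} {T : ℝ≥0}
variable {E : Type*} [NormedAddCommGroup E] [InnerProductSpace ℝ E]

/-- A function on `[0, T]` is càdlàg: right-continuous with left limits. -/
def IsCadlag {β : Type*} [TopologicalSpace β] (f : Set.Iic T → β) : Prop :=
  ∀ t, ContinuousWithinAt f (Set.Ici t) t ∧ ∃ l, Tendsto f (𝓝[<] t) (𝓝 l)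

/-- An adapted process with càdlàg paths. -/
def IsCadlagAdapted {β : Type*} [TopologicalSpace β] (𝓕 : Filtration (Set.Iic T) m)
    (X : Set.Iic T → Ω → β) : Prop :=
  StronglyAdapted 𝓕 X ∧ ∀ ω, IsCadlag fun t => X t ω

/-- A semimartingale on `[0, T]`: an adapted càdlàg process which is the sum of a càdlàg local
martingale and an adapted càdlàg process with paths of finite variation. -/
def IsSemimartingale [CompleteSpace E] (P : Measure Ω) (𝓕 : Filtration (Set.Iic T) m)
    (S : Set.Iic T → Ω → E) : Prop :=
  ∃ M A : Set.Iic T → Ω → E,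
    IsCadlagAdapted 𝓕 M ∧ Locally (fun N => Martingale N 𝓕 P) 𝓕 M P ∧
    IsCadlagAdapted 𝓕 A ∧ (∀ ω, BoundedVariationOn (fun t => A t ω) Set.univ) ∧ S = M + A

/-- Elementary predictable integrands
`ξ_∅ 1_{\{0\}} + ∑ i, ξ_i 1_{(s_i, t_i]}` with `ξ_i` bounded and `𝓕 (s_i)`-measurable. -/
structure ElementaryIntegrand (𝓕 : Filtration (Set.Iic T) m) (E : Type*)
    [NormedAddCommGroup E] where
  n : ℕ
  left : Fin n → Set.Iic T
  right : Fin n → Set.Iic T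
  left_le_right : ∀ i, left i ≤ right i
  initial : Ω → E
  coef : Fin n → Ω → E
  measurable_initial : StronglyMeasurable[𝓕 ⊥] initial
  measurable_coef : ∀ i, StronglyMeasurable[𝓕 (left i)] (coef i)
  bounded_initial : ∃ C : ℝ, ∀ ω, ‖initial ω‖ ≤ C
  bounded_coef : ∃ C : ℝ, ∀ i ω, ‖coef i ω‖ ≤ C

namespace ElementaryIntegrand

variable {𝓕 : Filtration (Set.Iic T) m}

/-- The process defined by an elementary integrand. -/
def process (K : ElementaryIntegrand 𝓕 E) (t : Set.Iic T) (ω : Ω) : E :=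
  Set.indicator {⊥} (fun _ => K.initial ω) t +
    ∑ i, Set.indicator (Set.Ioc (K.left i) (K.right i)) (fun _ => K.coef i ω) t

/-- The elementary integral `∫_{(0, t]} K dS`. -/
def integral (K : ElementaryIntegrand 𝓕 E) (S : Set.Iic T → Ω → E) (t : Set.Iic T) (ω : Ω) : ℝ :=
  ∑ i, inner ℝ (K.coef i ω) (S (min (K.right i) t) ω - S (min (K.left i) t) ω)

end ElementaryIntegrand

/-- Convergence in probability, uniformly over `[0, T]`. -/
def TendstoUCP (P : Measure Ω) (X : ℕ → Set.Iic T → Ω → ℝ) (X' : Set.Iic T → Ω → ℝ) : Prop :=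
  ∀ ε : ℝ, 0 < ε → Tendsto (fun n => P {ω | ∃ t, ε ≤ |X n t ω - X' t ω|}) atTop (𝓝 0)

/-- Convergence in the Émery (semimartingale) topology for processes with the same initial value:
uniform convergence in probability of `∫ K dX_n` to `∫ K dX'`, uniformly over all elementary
integrands `K` with values in `[-1, 1]`. -/
def TendstoEmery (P : Measure Ω) (𝓕 : Filtration (Set.Iic T) m)
    (X : ℕ → Set.Iic T → Ω → ℝ) (X' : Set.Iic T → Ω → ℝ) : Prop :=
  ∀ ε : ℝ, 0 < ε → Tendsto (fun n => ⨆ (K : ElementaryIntegrand 𝓕 ℝ)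
    (_ : ∀ t ω, |K.process t ω| ≤ 1), P {ω | ∃ t, ε ≤ |K.integral (X n - X') t ω|}) atTop (𝓝 0)

/-- `IsBoundedIntegral P 𝓕 S H X`: the bounded predictable process `H` has stochastic integral
`X = ∫ H dS`. The relation is the extension of the elementary integral by dominated convergence:
the smallest one which contains all elementary integrals and is closed under uniformly bounded
pointwise convergence of the integrands and uniform convergence in probability of the integrals. -/
inductive IsBoundedIntegral (P : Measure Ω) (𝓕 : Filtration (Set.Iic T) m)
    (S : Set.Iic T → Ω → E) : (Set.Iic T → Ω → E) → (Set.Iic T → Ω → ℝ) → Prop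
  | elementary (K : ElementaryIntegrand 𝓕 E) : IsBoundedIntegral P 𝓕 S K.process (K.integral S)
  | limit (H : ℕ → Set.Iic T → Ω → E) (X : ℕ → Set.Iic T → Ω → ℝ)
      (H' : Set.Iic T → Ω → E) (X' : Set.Iic T → Ω → ℝ) (C : ℝ)
      (integral : ∀ n, IsBoundedIntegral P 𝓕 S (H n) (X n))
      (bounded : ∀ n t ω, ‖H n t ω‖ ≤ C)
      (tendsto_integrand : ∀ t ω, Tendsto (fun n => H n t ω) atTop (𝓝 (H' t ω)))
      (cadlag : IsCadlagAdapted 𝓕 X')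
      (tendsto_integral : TendstoUCP P X X') : IsBoundedIntegral P 𝓕 S H' X'

/-- The truncated integrand `H 1_{|H| ≤ n}`. -/
def truncateNorm (H : Set.Iic T → Ω → E) (n : ℕ) (t : Set.Iic T) (ω : Ω) : E :=
  Set.indicator {x : E | ‖x‖ ≤ n} id (H t ω)

/-- `IsStochasticIntegral P 𝓕 S H G`: the predictable process `H` is `S`-integrable (in the sense
of vector stochastic integration) and `G = ∫ H dS`, that is, the integrals of the truncations
`H 1_{|H| ≤ n}` converge to `G` in the Émery topology. -/
def IsStochasticIntegral (P : Measure Ω) (𝓕 : Filtration (Set.Iic T) m)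
    (S : Set.Iic T → Ω → E) (H : Set.Iic T → Ω → E) (G : Set.Iic T → Ω → ℝ) : Prop :=
  IsStronglyPredictable 𝓕 H ∧ IsCadlagAdapted 𝓕 G ∧ G ⊥ =ᵐ[P] 0 ∧
    ∃ X : ℕ → Set.Iic T → Ω → ℝ,
      (∀ n, IsBoundedIntegral P 𝓕 S (truncateNorm H n) (X n)) ∧ TendstoEmery P 𝓕 X G

lemma isStochasticIntegral_zero (P : Measure Ω) (𝓕 : Filtration (Set.Iic T) m)
    (S : Set.Iic T → Ω → E) : IsStochasticIntegral P 𝓕 S 0 0 := by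
  let K : ElementaryIntegrand 𝓕 E :=
    { n := 0
      left := Fin.elim0
      right := Fin.elim0
      left_le_right := fun i => i.elim0
      initial := 0
      coef := fun i => i.elim0
      measurable_initial := stronglyMeasurable_zero
      measurable_coef := fun i => i.elim0
      bounded_initial := ⟨0, fun ω => by simp⟩
      bounded_coef := ⟨0, fun i => i.elim0⟩ }
  refine ⟨?_, ⟨fun t => stronglyMeasurable_zero, fun ω t => ⟨?_, 0, ?_⟩⟩, ae_eq_rfl,
    fun _ => 0, fun n => ?_, fun ε hε => ?_⟩
  · exact stronglyMeasurable_zero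
  · exact continuousWithinAt_const
  · exact tendsto_const_nhds
  · have h1 : truncateNorm (0 : Set.Iic T → Ω → E) n = K.process := by
      funext t ω
      simp [truncateNorm, ElementaryIntegrand.process, K]
    have h2 : (0 : Set.Iic T → Ω → ℝ) = K.integral S := by
      funext t ω
      simp [ElementaryIntegrand.integral, K]
    rw [h1, h2]
    exact .elementary K
  · simp [ElementaryIntegrand.integral, hε.not_ge]

end StochasticIntegration

/-! ## The financial market -/

section Market

variable {Ω : Type*} [m : MeasurableSpace Ω]

/-- A market with `d` stocks and a bond normalized to one: a semimartingale price process on a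
filtered probability space which satisfies the usual conditions. -/
structure Market (P : Measure Ω) where
  T : ℝ≥0
  d : ℕ
  𝓕 : Filtration (Set.Iic T) m
  rightContinuous : 𝓕.IsRightContinuous
  complete : ∀ s : Set Ω, P s = 0 → MeasurableSet[𝓕 ⊥] s
  S : Set.Iic T → Ω → EuclideanSpace ℝ (Fin d)
  semimartingale : IsSemimartingale P 𝓕 S

namespace Market

variable {P : Measure Ω} (M : Market P)

/-- The set `𝒳(x)` of nonnegative wealth processes `X = X₀ + ∫ H dS` with constant `0 ≤ X₀ ≤ x`
and `H` predictable and `S`-integrable. -/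
def wealth (x : ℝ) : Set (Set.Iic M.T → Ω → ℝ) :=
  {X | (∃ (x₀ : ℝ) (H : Set.Iic M.T → Ω → EuclideanSpace ℝ (Fin M.d)) (G : Set.Iic M.T → Ω → ℝ),
      0 ≤ x₀ ∧ x₀ ≤ x ∧ IsStochasticIntegral P M.𝓕 M.S H G ∧ X = fun t ω => x₀ + G t ω) ∧
    ∀ᵐ ω ∂P, ∀ t, 0 ≤ X t ω}

/-- The set `𝒴_P(y)` of nonnegative processes `Y` with `Y₀ = y` such that `XY` is a
supermartingale for every `X ∈ 𝒳(1)`. -/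
def deflators (y : ℝ) : Set (Set.Iic M.T → Ω → ℝ) :=
  {Y | (∀ t, ∀ᵐ ω ∂P, 0 ≤ Y t ω) ∧ (∀ᵐ ω ∂P, Y ⊥ ω = y) ∧
    ∀ X ∈ M.wealth 1, Supermartingale (fun t ω => X t ω * Y t ω) M.𝓕 P}

lemma one_mem_wealth : (fun _ _ => 1) ∈ M.wealth 1 :=
  ⟨⟨1, 0, 0, zero_le_one, le_rfl, isStochasticIntegral_zero P M.𝓕 M.S, by simp⟩,
    ae_of_all _ fun _ _ => zero_le_one⟩

lemma supermartingale_of_mem {y : ℝ} {Y : Set.Iic M.T → Ω → ℝ} (hY : Y ∈ M.deflators y) :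
    Supermartingale Y M.𝓕 P := by
  simpa using hY.2.2 _ M.one_mem_wealth

lemma convex_deflators {y : ℝ} : Convex ℝ (M.deflators y) := by
  intro Y hY Y' hY' a b ha hb hab
  refine ⟨fun t => ?_, ?_, fun X hX => ?_⟩
  · filter_upwards [hY.1 t, hY'.1 t] with ω h h'
    have : 0 ≤ a * Y t ω + b * Y' t ω := by positivity
    simpa using this
  · filter_upwards [hY.2.1, hY'.2.1] with ω h h'
    have : a * Y ⊥ ω + b * Y' ⊥ ω = y := by rw [h, h', ← add_mul, hab, one_mul]
    simpa using this
  · have h := ((hY.2.2 X hX).smul_nonneg ha).add ((hY'.2.2 X hX).smul_nonneg hb)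
    have e : (fun t ω => X t ω * (a • Y + b • Y') t ω) =
        (a • fun t ω => X t ω * Y t ω) + b • fun t ω => X t ω * Y' t ω := by
      funext t ω
      simp only [Pi.add_apply, Pi.smul_apply, smul_eq_mul]
      ring
    rw [e]
    exact h

lemma lintegral_terminal_le [IsProbabilityMeasure P] {Y : Set.Iic M.T → Ω → ℝ}
    (hY : Y ∈ M.deflators 1) : ∫⁻ ω, ENNReal.ofReal (Y ⊤ ω) ∂P ≤ 1 := by
  have hs := M.supermartingale_of_mem hY
  rw [← ofReal_integral_eq_lintegral_ofReal (hs.integrable ⊤) (hY.1 ⊤)]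
  refine ENNReal.ofReal_le_one.2 ?_
  have h := hs.setIntegral_le (i := ⊥) (j := ⊤) bot_le (s := Set.univ) MeasurableSet.univ
  rw [setIntegral_univ, setIntegral_univ] at h
  refine h.trans (le_of_eq ?_)
  rw [integral_congr_ae hY.2.1]
  simp

end Market

/-! ## Utility functions and the associated Young functions -/

/-- `U` is a utility function on `(0, ∞)` (strictly increasing, strictly concave, continuously
differentiable) which satisfies `U'(0+) = ∞`, `U'(+∞) = 0` and `U(0+) = 0`. -/
structure IsUtility (U : ℝ → ℝ) : Prop where
  strictMono : StrictMonoOn U (Set.Ioi 0)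
  strictConcave : StrictConcaveOn ℝ (Set.Ioi 0) U
  contDiff : ContDiffOn ℝ 1 U (Set.Ioi 0)
  inada_zero : Tendsto (deriv U) (𝓝[>] 0) atTop
  inada_top : Tendsto (deriv U) atTop (𝓝 0)
  zero : Tendsto U (𝓝[>] 0) (𝓝 0)

/-- The conjugate function `V(y) = sup_{x > 0} (U(x) - x y)`; in particular
`V(0) = lim_{x → ∞} U(x)`. -/
def conjugateV (U : ℝ → ℝ) (y : ℝ) : EReal := ⨆ (x : ℝ) (_ : 0 < x), ((U x - x * y : ℝ) : EReal)

/-- The inverse `U⁻¹` on `[0, ∞)`, with `U⁻¹(0) = 0` and `U⁻¹(y) = ∞` for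
`y ≥ lim_{x → ∞} U(x)`. -/
def inverseU (U : ℝ → ℝ) (y : ℝ) : ℝ≥0∞ := ⨅ (x : ℝ) (_ : 0 < x ∧ y ≤ U x), ENNReal.ofReal x

/-- `η*_y(z) = |z| V(y / |z|)`, with value `0` at `z = 0`. -/
def etaStar (U : ℝ → ℝ) (y z : ℝ) : ℝ≥0∞ :=
  ENNReal.ofReal |z| * (conjugateV U (y / |z|)).toENNReal

/-- `η_y(x) = y U⁻¹(|x|)`. -/
def eta (U : ℝ → ℝ) (y x : ℝ) : ℝ≥0∞ := ENNReal.ofReal y * inverseU U |x|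

variable {P : Measure Ω}

/-- The set `𝒴*` of all `Y ∈ 𝒴 = 𝒴_P(1)` with `Y_T > 0` a.s. and `E[V(β Y_T)] < ∞` for every
`β > 0`. -/
def Market.goodDeflators (M : Market P) (U : ℝ → ℝ) : Set (Set.Iic M.T → Ω → ℝ) :=
  {Y | Y ∈ M.deflators 1 ∧ (∀ᵐ ω ∂P, 0 < Y ⊤ ω) ∧
    ∀ β : ℝ, 0 < β → ∫⁻ ω, (conjugateV U (β * Y ⊤ ω)).toENNReal ∂P < ∞}

/-- `I(Z) = inf_{Y ∈ 𝒴} E[|Z| V(Y_T / |Z|)]`. -/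
def Market.funI (M : Market P) (U : ℝ → ℝ) (Z : Ω →ₘ[P] ℝ) : ℝ≥0∞ :=
  ⨅ Y ∈ M.deflators 1, ∫⁻ ω, etaStar U (Y ⊤ ω) (Z ω) ∂P

/-- `J(X) = sup_{Y ∈ 𝒴} E[Y_T U⁻¹(|X|)]`. -/
def Market.funJ (M : Market P) (U : ℝ → ℝ) (X : Ω →ₘ[P] ℝ) : ℝ≥0∞ :=
  ⨆ Y ∈ M.deflators 1, ∫⁻ ω, eta U (Y ⊤ ω) (X ω) ∂P

/-! ### Elementary properties, needed to see that `I` and `J` are modulars -/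

lemma IsUtility.pos {U : ℝ → ℝ} (hU : IsUtility U) {x : ℝ} (hx : 0 < x) : 0 < U x := by
  have h0 : (0 : ℝ) ≤ U (x / 2) := by
    refine le_of_tendsto hU.zero ?_
    filter_upwards [Ioo_mem_nhdsGT (half_pos hx)] with y hy
    exact (hU.strictMono hy.1 (half_pos hx) hy.2).le
  exact h0.trans_lt (hU.strictMono (half_pos hx) hx (half_lt_self hx))

lemma antitone_conjugateV (U : ℝ → ℝ) : Antitone (conjugateV U) := fun y y' h =>
  iSup₂_mono fun x hx => EReal.coe_le_coe_iff.2 (by nlinarith)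

lemma etaStar_eq (U : ℝ → ℝ) {y : ℝ} (hy : 0 ≤ y) (z : ℝ) :
    etaStar U y z = ⨆ (x : ℝ) (_ : 0 < x), ENNReal.ofReal (|z| * U x - x * y) := by
  rcases eq_or_ne z 0 with rfl | hz
  · simp only [etaStar, abs_zero, ENNReal.ofReal_zero, zero_mul, zero_sub]
    refine (le_antisymm (iSup₂_le fun x hx => ?_) bot_le).symm
    exact (ENNReal.ofReal_of_nonpos (by nlinarith)).le
  have hz' : 0 < |z| := abs_pos.2 hz
  have h1 : (conjugateV U (y / |z|)).toENNReal =
      ⨆ (x : ℝ) (_ : 0 < x), ENNReal.ofReal (U x - x * (y / |z|)) := by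
    refine le_antisymm ?_ (iSup₂_le fun x hx => ?_)
    · refine (EReal.toENNReal_le_toENNReal ?_).trans_eq EReal.toENNReal_coe
      refine iSup₂_le fun x hx => ?_
      refine le_trans ?_ (EReal.coe_ennreal_le_coe_ennreal_iff.2
        (le_iSup₂ (f := fun (x : ℝ) (_ : 0 < x) => ENNReal.ofReal (U x - x * (y / |z|))) x hx))
      rw [EReal.coe_ennreal_ofReal]
      exact EReal.coe_le_coe_iff.2 (le_max_left _ _)
    · rw [← EReal.real_coe_toENNReal]
      exact EReal.toENNReal_le_toENNReal
        (le_iSup₂ (f := fun (x : ℝ) (_ : 0 < x) => ((U x - x * (y / |z|) : ℝ) : EReal)) x hx)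
  rw [etaStar, h1]
  simp only [ENNReal.mul_iSup]
  refine biSup_congr fun x hx => ?_
  rw [← ENNReal.ofReal_mul hz'.le]
  congr 1
  field_simp

lemma etaStar_convex {U : ℝ → ℝ} (hU : IsUtility U) {a b y y' : ℝ} (ha : 0 ≤ a) (hb : 0 ≤ b)
    (hy : 0 ≤ y) (hy' : 0 ≤ y') (z z' : ℝ) :
    etaStar U (a * y + b * y') (a * z + b * z') ≤
      ENNReal.ofReal a * etaStar U y z + ENNReal.ofReal b * etaStar U y' z' := by
  rw [etaStar_eq U (by positivity), etaStar_eq U hy, etaStar_eq U hy']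
  refine iSup₂_le fun x hx => ?_
  have h1 := le_iSup₂ (f := fun (x : ℝ) (_ : 0 < x) => ENNReal.ofReal (|z| * U x - x * y)) x hx
  have h2 := le_iSup₂ (f := fun (x : ℝ) (_ : 0 < x) => ENNReal.ofReal (|z'| * U x - x * y')) x hx
  refine le_trans ?_ (add_le_add (mul_le_mul_right h1 _) (mul_le_mul_right h2 _))
  rw [← ENNReal.ofReal_mul ha, ← ENNReal.ofReal_mul hb]
  refine le_trans (ENNReal.ofReal_le_ofReal ?_) ENNReal.ofReal_add_le
  have h3 : |a * z + b * z'| ≤ a * |z| + b * |z'| := by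
    refine (abs_add_le _ _).trans (le_of_eq ?_)
    rw [abs_mul, abs_mul, abs_of_nonneg ha, abs_of_nonneg hb]
  nlinarith [mul_le_mul_of_nonneg_right h3 (hU.pos hx).le]

lemma young_etaStar (U : ℝ → ℝ) {y : ℝ} (hy : 0 ≤ y) (z : ℝ) :
    ENNReal.ofReal (|z| * U 1) ≤ etaStar U y z + ENNReal.ofReal y := by
  rw [etaStar_eq U hy]
  have h1 := le_iSup₂ (f := fun (x : ℝ) (_ : 0 < x) => ENNReal.ofReal (|z| * U x - x * y))
    1 one_pos
  refine le_trans ?_ (add_le_add_left h1 _)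
  refine le_trans (ENNReal.ofReal_le_ofReal ?_) ENNReal.ofReal_add_le
  linarith

lemma monotone_inverseU (U : ℝ → ℝ) : Monotone (inverseU U) := fun _ _ h =>
  le_iInf₂ fun x hx => iInf₂_le x ⟨hx.1, h.trans hx.2⟩

lemma inverseU_zero {U : ℝ → ℝ} (hU : IsUtility U) : inverseU U 0 = 0 := by
  refine le_antisymm (ENNReal.le_of_forall_pos_le_add fun ε hε _ => ?_) bot_le
  rw [zero_add]
  refine (iInf₂_le (ε : ℝ) ⟨hε, (hU.pos hε).le⟩).trans (le_of_eq ?_)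
  exact ENNReal.ofReal_coe_nnreal

lemma inverseU_convex {U : ℝ → ℝ} (hU : IsUtility U) {a b : ℝ} (ha : 0 < a) (hb : 0 < b)
    (hab : a + b = 1) (y y' : ℝ) :
    inverseU U (a * y + b * y') ≤
      ENNReal.ofReal a * inverseU U y + ENNReal.ofReal b * inverseU U y' := by
  have ha0 : ENNReal.ofReal a ≠ 0 := (ENNReal.ofReal_pos.2 ha).ne'
  have hb0 : ENNReal.ofReal b ≠ 0 := (ENNReal.ofReal_pos.2 hb).ne'
  unfold inverseU
  simp only [ENNReal.mul_iInf_of_ne ha0 ENNReal.ofReal_ne_top,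
    ENNReal.mul_iInf_of_ne hb0 ENNReal.ofReal_ne_top]
  refine ENNReal.le_iInf₂_add_iInf₂ fun x hx x' hx' => ?_
  rw [← ENNReal.ofReal_mul ha.le, ← ENNReal.ofReal_mul hb.le,
    ← ENNReal.ofReal_add (mul_nonneg ha.le hx.1.le) (mul_nonneg hb.le hx'.1.le)]
  have hpos : 0 < a * x + b * x' := add_pos (mul_pos ha hx.1) (mul_pos hb hx'.1)
  refine iInf₂_le (a * x + b * x') ⟨hpos, ?_⟩
  have h := hU.strictConcave.concaveOn.2 hx.1 hx'.1 ha.le hb.le hab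
  simp only [smul_eq_mul] at h
  nlinarith [mul_le_mul_of_nonneg_left hx.2 ha.le, mul_le_mul_of_nonneg_left hx'.2 hb.le]

lemma inverseU_eq_zero {U : ℝ → ℝ} (hU : IsUtility U) {y : ℝ} (h : inverseU U y = 0) : y ≤ 0 := by
  by_contra hy
  push Not at hy
  obtain ⟨δ, hδ, hδ'⟩ := (mem_nhdsGT_iff_exists_Ioo_subset).1 (hU.zero (Iio_mem_nhds hy))
  have hlt : inverseU U y < ENNReal.ofReal δ := by rw [h]; exact ENNReal.ofReal_pos.2 hδ
  simp only [inverseU, iInf_lt_iff] at hlt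
  obtain ⟨x, ⟨hx, hyx⟩, hxδ⟩ := hlt
  have := hδ' ⟨hx, (ENNReal.ofReal_lt_ofReal_iff hδ).1 hxδ⟩
  exact absurd hyx (not_le.2 this)

/-- The setting: a market, a utility function with `U(0+) = 0` that satisfies the Inada
conditions, and `𝒴* ≠ ∅`. -/
structure MarketSetting (P : Measure Ω) where
  market : Market P
  U : ℝ → ℝ
  utility : IsUtility U
  nonempty : (market.goodDeflators U).Nonempty

namespace MarketSetting

variable (A : MarketSetting P)

lemma aemeasurable_terminal {Y : Set.Iic A.market.T → Ω → ℝ} (hY : Y ∈ A.market.deflators 1) :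
    AEMeasurable (Y ⊤) P :=
  ((A.market.supermartingale_of_mem hY).integrable ⊤).aemeasurable

lemma aemeasurable_etaStar {Y : Set.Iic A.market.T → Ω → ℝ} (hY : Y ∈ A.market.deflators 1)
    (Z : Ω →ₘ[P] ℝ) : AEMeasurable (fun ω => etaStar A.U (Y ⊤ ω) (Z ω)) P := by
  have hV : Measurable fun y => (conjugateV A.U y).toENNReal :=
    Antitone.measurable fun y y' h => EReal.toENNReal_le_toENNReal (antitone_conjugateV A.U h)
  have hZ : AEMeasurable (fun ω => |Z ω|) P := Z.aestronglyMeasurable.aemeasurable.abs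
  exact hZ.ennreal_ofReal.mul (hV.comp_aemeasurable ((A.aemeasurable_terminal hY).div hZ))

lemma aemeasurable_eta {Y : Set.Iic A.market.T → Ω → ℝ} (hY : Y ∈ A.market.deflators 1)
    (X : Ω →ₘ[P] ℝ) : AEMeasurable (fun ω => eta A.U (Y ⊤ ω) (X ω)) P :=
  (A.aemeasurable_terminal hY).ennreal_ofReal.mul
    ((monotone_inverseU A.U).measurable.comp_aemeasurable X.aestronglyMeasurable.aemeasurable.abs)

lemma coeFn_comb (a b : ℝ) (Z W : Ω →ₘ[P] ℝ) :
    (a • Z + b • W : Ω →ₘ[P] ℝ) =ᵐ[P] fun ω => a * Z ω + b * W ω := by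
  filter_upwards [AEEqFun.coeFn_add (a • Z) (b • W), AEEqFun.coeFn_smul a Z,
    AEEqFun.coeFn_smul b W] with ω h1 h2 h3
  rw [h1, Pi.add_apply, h2, h3]
  rfl

/-- The functional `I` as a modular on `L⁰`. -/
def modI [IsProbabilityMeasure P] : ConvexModular (Ω →ₘ[P] ℝ) where
  toFun := A.market.funI A.U
  map_zero' := by
    obtain ⟨Y, hY, -⟩ := A.nonempty
    refine le_antisymm ((iInf₂_le Y hY).trans (le_of_eq ?_)) bot_le
    rw [lintegral_eq_zero_iff' (A.aemeasurable_etaStar hY 0)]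
    filter_upwards [AEEqFun.coeFn_zero (α := Ω) (β := ℝ) (μ := P)] with ω h
    simp [h, etaStar]
  map_neg' Z := by
    refine biInf_congr fun Y hY => lintegral_congr_ae ?_
    filter_upwards [AEEqFun.coeFn_neg Z] with ω h
    rw [h, Pi.neg_apply, etaStar, etaStar, abs_neg]
  convex' := by
    intro a b ha hb hab Z W
    rcases eq_or_lt_of_le ha with rfl | ha
    · obtain rfl : b = 1 := by linarith
      simp
    rcases eq_or_lt_of_le hb with rfl | hb
    · obtain rfl : a = 1 := by linarith
      simp
    have ha0 : ENNReal.ofReal a ≠ 0 := (ENNReal.ofReal_pos.2 ha).ne'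
    have hb0 : ENNReal.ofReal b ≠ 0 := (ENNReal.ofReal_pos.2 hb).ne'
    unfold Market.funI
    simp only [ENNReal.mul_iInf_of_ne ha0 ENNReal.ofReal_ne_top,
      ENNReal.mul_iInf_of_ne hb0 ENNReal.ofReal_ne_top]
    refine ENNReal.le_iInf₂_add_iInf₂ fun Y hY Y' hY' => ?_
    refine (iInf₂_le (a • Y + b • Y')
      (A.market.convex_deflators hY hY' ha.le hb.le hab)).trans ?_
    rw [← lintegral_const_mul' _ _ ENNReal.ofReal_ne_top,
      ← lintegral_const_mul' _ _ ENNReal.ofReal_ne_top,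
      ← lintegral_add_left' ((A.aemeasurable_etaStar hY Z).const_mul _)]
    refine lintegral_mono_ae ?_
    filter_upwards [coeFn_comb a b Z W, hY.1 ⊤, hY'.1 ⊤] with ω h hy hy'
    rw [h]
    exact etaStar_convex A.utility ha.le hb.le hy hy' _ _
  definite' Z h := by
    have hU1 : 0 < A.U 1 := A.utility.pos one_pos
    set C := ∫⁻ ω, ENNReal.ofReal (|Z ω| * A.U 1) ∂P with hC
    have key : ∀ ξ : ℝ, 0 < ξ → ENNReal.ofReal ξ * C ≤ 1 := by
      intro ξ hξ
      have h1 : ∀ Y ∈ A.market.deflators 1, ENNReal.ofReal ξ * C ≤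
          (∫⁻ ω, etaStar A.U (Y ⊤ ω) ((ξ • Z : Ω →ₘ[P] ℝ) ω) ∂P) + 1 := by
        intro Y hY
        refine le_trans ?_ (add_le_add_right (A.market.lintegral_terminal_le hY) _)
        rw [← lintegral_add_left' (A.aemeasurable_etaStar hY _), hC,
          ← lintegral_const_mul' _ _ ENNReal.ofReal_ne_top]
        refine lintegral_mono_ae ?_
        filter_upwards [AEEqFun.coeFn_smul ξ Z, hY.1 ⊤] with ω hω hy
        refine le_trans (le_of_eq ?_) (young_etaStar A.U hy _)
        rw [hω, Pi.smul_apply, smul_eq_mul, abs_mul, abs_of_pos hξ, ← ENNReal.ofReal_mul hξ.le,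
          mul_assoc]
      have h2 : ENNReal.ofReal ξ * C ≤ A.market.funI A.U (ξ • Z) + 1 := by
        rw [Market.funI, ENNReal.iInf_add]
        refine le_iInf fun Y => ?_
        by_cases hY : Y ∈ A.market.deflators 1
        · simpa [hY] using h1 Y hY
        · simp [hY]
      rwa [h ξ hξ, zero_add] at h2
    have hC0 : C = 0 := by
      by_contra hne
      have htop : C ≠ ∞ := by
        intro htop
        have := key 1 one_pos
        simp [htop] at this
      have h2 := key (2 / C.toReal) (div_pos two_pos (ENNReal.toReal_pos hne htop))
      rw [← ENNReal.ofReal_toReal htop, ← ENNReal.ofReal_mul (by positivity),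
        ENNReal.toReal_ofReal ENNReal.toReal_nonneg,
        div_mul_cancel₀ _ (ENNReal.toReal_pos hne htop).ne', ENNReal.ofReal_le_one] at h2
      norm_num at h2
    rw [hC, lintegral_eq_zero_iff'
      (Z.aestronglyMeasurable.aemeasurable.abs.mul_const _).ennreal_ofReal] at hC0
    refine AEEqFun.ext ?_
    filter_upwards [hC0, AEEqFun.coeFn_zero (α := Ω) (β := ℝ) (μ := P)] with ω h1 h2
    rw [h2]
    have h3 : |Z ω| * A.U 1 ≤ 0 := ENNReal.ofReal_eq_zero.1 h1
    have h4 : |Z ω| ≤ 0 := nonpos_of_mul_nonpos_left h3 hU1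
    simpa using h4

/-- The functional `J` as a modular on `L⁰`. -/
def modJ [IsProbabilityMeasure P] : ConvexModular (Ω →ₘ[P] ℝ) where
  toFun := A.market.funJ A.U
  map_zero' := by
    refine le_antisymm (iSup₂_le fun Y hY => le_of_eq ?_) bot_le
    rw [lintegral_eq_zero_iff' (A.aemeasurable_eta hY 0)]
    filter_upwards [AEEqFun.coeFn_zero (α := Ω) (β := ℝ) (μ := P)] with ω h
    simp [h, eta, inverseU_zero A.utility]
  map_neg' X := by
    refine biSup_congr fun Y hY => lintegral_congr_ae ?_
    filter_upwards [AEEqFun.coeFn_neg X] with ω h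
    rw [h, Pi.neg_apply, eta, eta, abs_neg]
  convex' := by
    intro a b ha hb hab X W
    rcases eq_or_lt_of_le ha with rfl | ha
    · obtain rfl : b = 1 := by linarith
      simp
    rcases eq_or_lt_of_le hb with rfl | hb
    · obtain rfl : a = 1 := by linarith
      simp
    refine iSup₂_le fun Y hY => ?_
    have h1 := le_iSup₂ (f := fun Y (_ : Y ∈ A.market.deflators 1) =>
      ∫⁻ ω, eta A.U (Y ⊤ ω) (X ω) ∂P) Y hY
    have h2 := le_iSup₂ (f := fun Y (_ : Y ∈ A.market.deflators 1) =>
      ∫⁻ ω, eta A.U (Y ⊤ ω) (W ω) ∂P) Y hY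
    refine le_trans ?_ (add_le_add (mul_le_mul_right h1 _) (mul_le_mul_right h2 _))
    rw [← lintegral_const_mul' _ _ ENNReal.ofReal_ne_top,
      ← lintegral_const_mul' _ _ ENNReal.ofReal_ne_top,
      ← lintegral_add_left' ((A.aemeasurable_eta hY X).const_mul _)]
    refine lintegral_mono_ae ?_
    filter_upwards [coeFn_comb a b X W] with ω h
    rw [h]
    have h3 : |a * X ω + b * W ω| ≤ a * |X ω| + b * |W ω| := by
      refine (abs_add_le _ _).trans (le_of_eq ?_)
      rw [abs_mul, abs_mul, abs_of_pos ha, abs_of_pos hb]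
    calc eta A.U (Y ⊤ ω) (a * X ω + b * W ω)
        ≤ ENNReal.ofReal (Y ⊤ ω) * (ENNReal.ofReal a * inverseU A.U |X ω| +
            ENNReal.ofReal b * inverseU A.U |W ω|) := by
          unfold eta
          gcongr
          exact (monotone_inverseU A.U h3).trans (inverseU_convex A.utility ha hb hab _ _)
      _ = _ := by
          unfold eta
          ring
  definite' X h := by
    obtain ⟨Y, hY, hpos, -⟩ := A.nonempty
    have h1 := h 1 one_pos
    rw [one_smul] at h1
    have h2 : ∫⁻ ω, eta A.U (Y ⊤ ω) (X ω) ∂P = 0 :=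
      le_antisymm ((le_iSup₂ (f := fun Y (_ : Y ∈ A.market.deflators 1) =>
        ∫⁻ ω, eta A.U (Y ⊤ ω) (X ω) ∂P) Y hY).trans h1.le) bot_le
    rw [lintegral_eq_zero_iff' (A.aemeasurable_eta hY X)] at h2
    refine AEEqFun.ext ?_
    filter_upwards [h2, hpos, AEEqFun.coeFn_zero (α := Ω) (β := ℝ) (μ := P)] with ω h3 h4 h5
    rw [h5]
    have h6 : inverseU A.U |X ω| = 0 :=
      (mul_eq_zero.1 h3).resolve_left (ENNReal.ofReal_pos.2 h4).ne'
    simpa using inverseU_eq_zero A.utility h6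

end MarketSetting
end Market

end

/-! For a fixed deflator, `etaStar` and `eta` form a Young pair: `|z||x| ≤ η*_y(z) + η_y(x)`
wherever `U⁻¹(|x|)` is finite, and truncations of `η_y(x)` are recovered from `z x - η*_y(z)` at
explicit bounded `z`. Since `I` is an infimum over deflators and `J` a supremum, conjugating `I`
only involves a supremum over `Z` and a supremum over `Y`, which commute. Hence `I* = J` without any
minimax argument. What remains is to move the supremum over `Z` inside the expectation. This is done
by a measurable bounded near-maximizer, so bounded `Z` already suffice
(`modJ_le_of_forall_bounded`). Bounded variables belong to `E_I` because of the good deflator.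

Young's inequality applied to `kZ` and `X/β` gives Hölder's inequality, so `X` acts on `L_I` with
norm at most its Luxemburg norm. Conversely, if `l = E[· X]` on bounded variables and `‖l‖ ≤ β`,
then `E[ZX]/β ≤ ‖Z‖ ≤ 1 + I(Z)`, and conjugation over bounded `Z` gives `J(X/β) ≤ 1`
(`modJ_le_one_of_norm_le`). This yields the isometry, and it also puts the densities found below
into `L_J`.

For surjectivity, the Amemiya norm is order continuous on `E_I` (`tendsto_norm_zero`, by dominated
convergence under a single deflator). So `B ↦ l(1_B)` is a signed measure absolutely continuous with
respect to `P`, its Radon–Nikodym derivative represents `l` on simple functions, and these are dense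
in `E_I`.

If `E_I = L_I`, then `I` is finite, convex and bounded on the unit ball, hence continuous with a
continuous subgradient `l` at every `Z`. By surjectivity `l` is given by some `X ∈ L_J`, and `J(X) =
I*(l) ≤ l(Z) - I(Z)`, so this `X` attains the supremum in `J*(l_Z) = I(Z)`. -/

noncomputable section

/-! ### Pointwise Young duality for the utility function. -/

section UtilityLemmas

variable {U : ℝ → ℝ}

lemma IsUtility.differentiableAt (hU : IsUtility U) {u : ℝ} (hu : 0 < u) :
    DifferentiableAt ℝ U u :=
  (hU.contDiff.differentiableOn one_ne_zero).differentiableAt (Ioi_mem_nhds hu)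

lemma IsUtility.antitoneOn_deriv (hU : IsUtility U) : AntitoneOn (deriv U) (Set.Ioi 0) :=
  hU.strictConcave.concaveOn.antitoneOn_deriv fun _ hx => hU.differentiableAt hx

/-- The graph of a utility function lies below its tangents. -/
lemma IsUtility.le_tangent (hU : IsUtility U) {u x : ℝ} (hu : 0 < u) (hx : 0 < x) :
    U x ≤ U u + deriv U u * (x - u) := by
  have hc := hU.strictConcave.concaveOn
  rcases lt_trichotomy x u with h | rfl | h
  · have h1 := hc.deriv_le_slope hx hu h (hU.differentiableAt hu)
    rw [slope_def_field, le_div_iff₀ (sub_pos.2 h)] at h1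
    linarith
  · simp
  · have h1 := hc.slope_le_deriv hu hx h (hU.differentiableAt hu)
    rw [slope_def_field, div_le_iff₀ (sub_pos.2 h)] at h1
    linarith

lemma IsUtility.deriv_pos (hU : IsUtility U) {u : ℝ} (hu : 0 < u) : 0 < deriv U u := by
  have h1 := hU.le_tangent hu (by linarith : 0 < u + 1)
  have h2 := hU.strictMono hu (by simp; linarith : u + 1 ∈ Set.Ioi 0) (by linarith)
  linarith

/-- Since `U ≥ 0`, the tangent at `u` has nonnegative intercept at the origin. This later guarantees
that the positive part in `etaStar` loses nothing at the near-maximizer. -/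
lemma IsUtility.mul_deriv_le (hU : IsUtility U) {u : ℝ} (hu : 0 < u) : u * deriv U u ≤ U u := by
  have h1 : ∀ᶠ x in 𝓝[>] (0 : ℝ), 0 ≤ U u + deriv U u * (x - u) := by
    filter_upwards [self_mem_nhdsWithin] with x hx
    exact (hU.pos hx).le.trans (hU.le_tangent hu hx)
  have h2 : Tendsto (fun x => U u + deriv U u * (x - u)) (𝓝[>] 0)
      (𝓝 (U u + deriv U u * (0 - u))) :=
    ((by fun_prop : Continuous fun x => U u + deriv U u * (x - u)).tendsto 0).mono_left
      nhdsWithin_le_nhds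
  have := ge_of_tendsto h2 h1
  linarith

/-- Young's inequality for the pair `η`, `η*`. -/
lemma ofReal_mul_le_etaStar_add_eta {y x : ℝ} (hy : 0 ≤ y) (z : ℝ)
    (hx : inverseU U |x| ≠ ∞) :
    ENNReal.ofReal (|z| * |x|) ≤ etaStar U y z + eta U y x := by
  have key : ∀ u : ℝ, (0 < u ∧ |x| ≤ U u) → ENNReal.ofReal (|z| * |x|) ≤
      etaStar U y z + ENNReal.ofReal y * ENNReal.ofReal u := by
    intro u hu
    rw [etaStar_eq U hy, ← ENNReal.ofReal_mul hy]
    have h1 := le_iSup₂ (f := fun (x : ℝ) (_ : 0 < x) => ENNReal.ofReal (|z| * U x - x * y))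
      u hu.1
    refine le_trans ?_ (add_le_add_left h1 _)
    refine le_trans (ENNReal.ofReal_le_ofReal ?_) ENNReal.ofReal_add_le
    nlinarith [mul_le_mul_of_nonneg_left hu.2 (abs_nonneg z)]
  -- For `y = 0` the convention `0 · ∞ = 0` would break the inequality; finiteness of `U⁻¹(|x|)`
  -- supplies an admissible `u`, whose cost is then zero. For `y > 0` the factor passes through the
  -- infimum.
  rcases hy.eq_or_lt with rfl | hy'
  · obtain ⟨u, hu⟩ : ∃ u : ℝ, 0 < u ∧ |x| ≤ U u := by
      by_contra h
      push Not at h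
      refine hx (iInf₂_eq_top.2 fun u hu => absurd hu.2 (not_le.2 (h u hu.1)))
    simpa [eta] using key u hu
  · have h0 : ENNReal.ofReal y ≠ 0 := (ENNReal.ofReal_pos.2 hy').ne'
    rw [eta, inverseU]
    simp only [ENNReal.mul_iInf_of_ne h0 ENNReal.ofReal_ne_top, ENNReal.add_iInf]
    exact le_iInf₂ key

lemma etaStar_zero (U : ℝ → ℝ) (y : ℝ) : etaStar U y 0 = 0 := by simp [etaStar]

/-- `η*_y(z) / |z|` is nondecreasing in `|z|`. -/
lemma etaStar_le_mul {y z z' : ℝ} (hy : 0 ≤ y) (h : |z'| ≤ |z|) :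
    etaStar U y z' ≤ ENNReal.ofReal |z'| * (conjugateV U (y / |z|)).toENNReal := by
  rcases eq_or_ne z' 0 with rfl | hz
  · simp [etaStar]
  have hz' : 0 < |z'| := abs_pos.2 hz
  unfold etaStar
  gcongr
  refine EReal.toENNReal_le_toENNReal (antitone_conjugateV U ?_)
  gcongr

lemma etaStar_mono {y z z' : ℝ} (hy : 0 ≤ y) (h : |z'| ≤ |z|) : etaStar U y z' ≤ etaStar U y z :=
  (etaStar_le_mul hy h).trans (by unfold etaStar; gcongr)

lemma measurable_inverseU_abs (U : ℝ → ℝ) : Measurable fun x : ℝ => inverseU U |x| :=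
  (monotone_inverseU U).measurable.comp (by fun_prop)

/-- `U⁻¹(|x|)`, truncated at level `n`. -/
def truncInverse (U : ℝ → ℝ) (n : ℕ) (x : ℝ) : ℝ := (min (inverseU U |x|) n).toReal

lemma measurable_truncInverse (U : ℝ → ℝ) (n : ℕ) : Measurable (truncInverse U n) :=
  ((measurable_inverseU_abs U).min measurable_const).ennreal_toReal

lemma ofReal_truncInverse (U : ℝ → ℝ) (n : ℕ) (x : ℝ) :
    ENNReal.ofReal (truncInverse U n x) = min (inverseU U |x|) n :=
  ENNReal.ofReal_toReal (by simp)

lemma truncInverse_le (U : ℝ → ℝ) (n : ℕ) (x : ℝ) : truncInverse U n x ≤ n := by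
  have := ENNReal.toReal_mono (ENNReal.natCast_ne_top n) (min_le_right (inverseU U |x|) n)
  simpa [truncInverse] using this

lemma truncInverse_pos (hU : IsUtility U) {n : ℕ} (hn : 0 < n) {x : ℝ} (hx : x ≠ 0) :
    0 < truncInverse U n x := by
  refine ENNReal.toReal_pos (fun h => ?_) (by simp)
  rcases min_eq_bot.1 h with h | h
  · exact absurd (inverseU_eq_zero hU h) (not_le.2 (abs_pos.2 hx))
  · simp at h; omega

/-- A `v` below the truncated inverse with `U v > |x|` would compete in the infimum defining
`U⁻¹(|x|)` and lower it; continuity of `U` extends the bound to the endpoint. -/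
lemma truncInverse_utility_le (hU : IsUtility U) {n : ℕ} (hn : 0 < n) {x : ℝ} (hx : x ≠ 0) :
    U (truncInverse U n x) ≤ |x| := by
  have hpos := truncInverse_pos hU hn hx
  refine le_of_tendsto ((hU.differentiableAt hpos).continuousAt.tendsto.mono_left
    (nhdsWithin_le_nhds (s := Set.Iio (truncInverse U n x)))) ?_
  filter_upwards [Ioo_mem_nhdsLT hpos] with v hv
  by_contra hlt
  push Not at hlt
  have h1 : inverseU U |x| ≤ ENNReal.ofReal v := iInf₂_le v ⟨hv.1, hlt.le⟩
  have h2 : ENNReal.ofReal (truncInverse U n x) ≤ ENNReal.ofReal v := by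
    rw [ofReal_truncInverse]
    exact (min_le_left _ _).trans h1
  exact absurd ((ENNReal.ofReal_le_ofReal_iff hv.1.le).1 h2) (not_le.2 hv.2)

/-- A bounded near-maximizer of `z ↦ z x - η*_y(z)`. -/
def nearMaximizer (U : ℝ → ℝ) (n : ℕ) (y x : ℝ) : ℝ :=
  if 0 ≤ y ∧ y ≤ n then SignType.sign x * (y / deriv U (truncInverse U n x)) else 0

lemma measurable_nearMaximizer (U : ℝ → ℝ) (n : ℕ) :
    Measurable fun p : ℝ × ℝ => nearMaximizer U n p.1 p.2 := by
  unfold nearMaximizer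
  refine Measurable.ite ?_ ?_ measurable_const
  · exact measurableSet_Icc.preimage (f := fun p : ℝ × ℝ => p.1) measurable_fst
  · have h1 : Measurable fun x : ℝ => ((SignType.sign x : SignType) : ℝ) := by
      refine Monotone.measurable fun a b h => ?_
      have := SignType.sign.monotone h
      revert this
      cases SignType.sign a <;> cases SignType.sign b <;> simp
    exact (h1.comp measurable_snd).mul (measurable_fst.div
      ((measurable_deriv U).comp ((measurable_truncInverse U n).comp measurable_snd)))

/-- Both cutoffs enter: `y ≤ n` bounds the numerator, and a truncated inverse of at most `n` bounds
the denominator below by `U'(n)`, because `U'` decreases. -/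
lemma abs_nearMaximizer_le (hU : IsUtility U) {n : ℕ} (hn : 0 < n) (y x : ℝ) :
    |nearMaximizer U n y x| ≤ n / deriv U n := by
  have hn' : (0 : ℝ) < n := by exact_mod_cast hn
  have hd := hU.deriv_pos hn'
  unfold nearMaximizer
  split_ifs with h
  · rcases eq_or_ne x 0 with rfl | hx
    · simp; positivity
    have hpos := truncInverse_pos hU hn hx
    have hle := hU.antitoneOn_deriv hpos hn' (truncInverse_le U n x)
    have hd' := hU.deriv_pos hpos
    have hs : |((SignType.sign x : SignType) : ℝ)| = 1 := by
      rcases lt_or_gt_of_ne hx with h | h <;> simp [h]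
    rw [abs_mul, hs, one_mul, abs_of_nonneg (div_nonneg h.1 hd'.le)]
    exact div_le_div₀ hn'.le h.2 hd hle
  · simp; positivity

lemma nearMaximizer_mul_nonneg (hU : IsUtility U) {n : ℕ} (hn : 0 < n) (y x : ℝ) :
    0 ≤ nearMaximizer U n y x * x := by
  unfold nearMaximizer
  split_ifs with h
  · rcases eq_or_ne x 0 with rfl | hx
    · simp
    have hd' := hU.deriv_pos (truncInverse_pos hU hn hx)
    have : 0 ≤ |x| * (y / deriv U (truncInverse U n x)) :=
      mul_nonneg (abs_nonneg _) (div_nonneg h.1 hd'.le)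
    rw [← sign_mul_self x] at this
    linarith
  · simp

/-- With `u` the truncated inverse, `|z| = y / U'(u)` is the first-order condition making `v = u`
maximal in `|z| U(v) - v y`. Hence `η*_y(z)` is at most `|z| U(u) - u y`, and `U(u) ≤ |x|` gives the
second estimate. The first one, a constant bound, makes `E[η*]` finite, so that it can be cancelled
later. -/
lemma etaStar_nearMaximizer_le (hU : IsUtility U) {n : ℕ} (hn : 0 < n) {y x : ℝ} (hy : 0 ≤ y) :
    etaStar U y (nearMaximizer U n y x) ≤ ENNReal.ofReal (n / deriv U n * U n) ∧
    ENNReal.ofReal (if y ≤ n then y else 0) * min (inverseU U |x|) n +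
      etaStar U y (nearMaximizer U n y x) ≤ ENNReal.ofReal (nearMaximizer U n y x * x) := by
  have hbd := abs_nearMaximizer_le hU hn y x
  have hn' : (0 : ℝ) < n := by exact_mod_cast hn
  by_cases hyn : y ≤ n
  · rcases eq_or_ne x 0 with rfl | hx
    · simp [nearMaximizer, etaStar, inverseU_zero hU]
    set u := truncInverse U n x with hu
    have hpos : 0 < u := truncInverse_pos hU hn hx
    have hd := hU.deriv_pos hpos
    have hs : |((SignType.sign x : SignType) : ℝ)| = 1 := by
      rcases lt_or_gt_of_ne hx with h | h <;> simp [h]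
    have hz : |nearMaximizer U n y x| = y / deriv U u := by
      rw [nearMaximizer, if_pos ⟨hy, hyn⟩, abs_mul, hs, one_mul,
        abs_of_nonneg (div_nonneg hy hd.le)]
    have hzd : |nearMaximizer U n y x| * deriv U u = y := by rw [hz, div_mul_cancel₀ _ hd.ne']
    have hzx : nearMaximizer U n y x * x = |nearMaximizer U n y x| * |x| := by
      rw [← abs_mul, abs_of_nonneg (nearMaximizer_mul_nonneg hU hn y x)]
    set z := nearMaximizer U n y x
    -- The tangent inequality at `u`, multiplied by `|z|`, has slope exactly `y`.
    have h1 : etaStar U y z ≤ ENNReal.ofReal (|z| * U u - u * y) := by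
      rw [etaStar_eq U hy]
      refine iSup₂_le fun v hv => ENNReal.ofReal_le_ofReal ?_
      have := mul_le_mul_of_nonneg_left (hU.le_tangent hpos hv) (abs_nonneg z)
      have e : |z| * (U u + deriv U u * (v - u)) = |z| * U u + (|z| * deriv U u) * (v - u) := by
        ring
      rw [e, hzd] at this
      linarith
    have h0 : 0 ≤ |z| * U u - u * y := by
      rw [← hzd]
      have := mul_le_mul_of_nonneg_left (hU.mul_deriv_le hpos) (abs_nonneg z)
      linarith
    refine ⟨h1.trans (ENNReal.ofReal_le_ofReal ?_), ?_⟩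
    · have h2 : U u ≤ U n := hU.strictMono.monotoneOn hpos hn' (truncInverse_le U n x)
      have := mul_le_mul hbd h2 (hU.pos hpos).le ((abs_nonneg z).trans hbd)
      have := mul_nonneg hpos.le hy
      linarith
    · rw [if_pos hyn, ← ofReal_truncInverse, ← ENNReal.ofReal_mul hy, hzx]
      refine (add_le_add_right h1 _).trans ?_
      rw [← ENNReal.ofReal_add (mul_nonneg hy hpos.le) h0]
      refine ENNReal.ofReal_le_ofReal ?_
      have := mul_le_mul_of_nonneg_left (truncInverse_utility_le hU hn hx) (abs_nonneg z)
      rw [← hu] at *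
      linarith
  · have : nearMaximizer U n y x = 0 := if_neg fun h => hyn h.2
    simp [this, etaStar, hyn]

lemma monotone_truncated_eta (U : ℝ → ℝ) (y x : ℝ) :
    Monotone fun n : ℕ => ENNReal.ofReal (if y ≤ n then y else 0) * min (inverseU U |x|) n := by
  intro k n h
  have hkn : (k : ℝ) ≤ n := by exact_mod_cast h
  refine mul_le_mul' ?_ (min_le_min le_rfl (by exact_mod_cast h))
  by_cases hy : y ≤ k
  · rw [if_pos hy, if_pos (hy.trans hkn)]
  · simp [hy]

lemma iSup_truncated_eta (U : ℝ → ℝ) (y x : ℝ) :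
    ⨆ n : ℕ, ENNReal.ofReal (if y ≤ n then y else 0) * min (inverseU U |x|) n = eta U y x := by
  have h2 : ⨆ n : ℕ, min (inverseU U |x|) (n : ℝ≥0∞) = inverseU U |x| := by
    rw [← inf_iSup_eq, ENNReal.iSup_natCast, inf_top_eq]
  refine le_antisymm (iSup_le fun n => ?_) ?_
  · refine mul_le_mul' ?_ (min_le_left _ _)
    split_ifs <;> simp
  · refine le_trans (le_of_eq (by rw [eta, h2])) (?_ : ENNReal.ofReal y *
      (⨆ n : ℕ, min (inverseU U |x|) (n : ℝ≥0∞)) ≤ _)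
    rw [ENNReal.mul_iSup]
    -- From the index `k ≥ y` on, the cutoff in `y` is inactive, so the term at `max k n` dominates.
    obtain ⟨k, hk⟩ := exists_nat_ge y
    refine iSup_le fun n => ?_
    refine le_trans ?_ (le_iSup _ (max k n))
    have hk' : y ≤ (max k n : ℕ) := hk.trans (by exact_mod_cast le_max_left k n)
    rw [if_pos hk']
    gcongr
    exact le_max_right k n

end UtilityLemmas
end

/-! ### Continuous subgradients and estimates for the two modular norms. -/

noncomputable section

/-- A convex function which is bounded above near a point has a continuous subgradient at every
point. -/
lemma ConvexOn.exists_subgradient {E : Type*} [NormedAddCommGroup E] [NormedSpace ℝ E]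
    {f : E → ℝ} (hf : ConvexOn ℝ Set.univ f) (hb : (𝓝 (0 : E)).IsBoundedUnder (· ≤ ·) f)
    (x : E) : ∃ l : StrongDual ℝ E, ∀ y, f x + l (y - x) ≤ f y := by
  have hcont : Continuous f := by
    rw [← continuousOn_univ]
    have h := (hf.continuousOn_tfae isOpen_univ Set.univ_nonempty).out 1 3
    exact h.2 ⟨0, trivial, hb⟩
  -- The strict epigraph is open by continuity of `f`, so Hahn–Banach separates it from the graph
  -- point at `x`.
  set s : Set (E × ℝ) := {p | f p.1 < p.2}
  have hs : IsOpen s := isOpen_lt (hcont.comp continuous_fst) continuous_snd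
  have hsc : Convex ℝ s := by simpa [s] using hf.convex_strict_epigraph
  obtain ⟨g, hg⟩ := geometric_hahn_banach_open_point hsc hs
    (show (x, f x) ∉ s from lt_irrefl (f x))
  have hgd : ∀ y t, g (y, t) = g (y, 0) + t * g (0, 1) := by
    intro y t
    rw [← smul_eq_mul, ← map_smul, ← map_add]
    simp
  set c := g (0, 1)
  -- The separating hyperplane is not vertical: the point one unit above the graph point lies in the
  -- epigraph. Dividing by `-c` then turns the functional into a subgradient.
  have hc : c < 0 := by
    have := hg (x, f x + 1) (by simp [s])
    rw [hgd x (f x + 1), hgd x (f x)] at this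
    linarith
  refine ⟨(-c)⁻¹ • g.comp (ContinuousLinearMap.inl ℝ E ℝ), fun y => ?_⟩
  have hle : g (y, f y) ≤ g (x, f x) := by
    have ht : Tendsto (fun t : ℝ => g (y, t)) (𝓝[>] (f y)) (𝓝 (g (y, f y))) :=
      ((by fun_prop : Continuous fun t : ℝ => g (y, t)).tendsto _).mono_left nhdsWithin_le_nhds
    refine le_of_tendsto ht ?_
    filter_upwards [self_mem_nhdsWithin] with t ht
    exact (hg (y, t) ht).le
  rw [hgd y, hgd x] at hle
  have e : g (y - x, 0) = g (y, 0) - g (x, 0) := by rw [← map_sub]; simp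
  simp only [smul_apply, ContinuousLinearMap.comp_apply,
    ContinuousLinearMap.inl_apply, smul_eq_mul, e]
  rw [← sub_nonneg]
  have : 0 ≤ (-c)⁻¹ * ((-c) * (f y - f x) - (g (y, 0) - g (x, 0))) :=
    mul_nonneg (inv_nonneg.2 (by linarith)) (by linarith)
  rw [mul_sub, ← mul_assoc, inv_mul_cancel₀ (by linarith), one_mul] at this
  linarith

namespace ConvexModular

variable {S : Type*} [AddCommGroup S] [Module ℝ S] (F : ConvexModular S)

lemma norm_ame_def (s : F.Ame) : ‖s‖ = (F.amemiyaE s.val).toReal := rfl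

lemma norm_ame_le (s : F.Ame) {k : ℝ} (hk : 0 < k) {c : ℝ} (hc : 0 ≤ c)
    (h : F (k • s.val) ≤ ENNReal.ofReal c) : ‖s‖ ≤ (1 + c) / k := by
  have h1 := (F.amemiyaE_le s.val hk).trans (add_le_add_right (ENNReal.div_le_div_right h _) _)
  rw [norm_ame_def]
  refine ENNReal.toReal_le_of_le_ofReal (by positivity) (h1.trans (le_of_eq ?_))
  rw [← ENNReal.ofReal_one, ← ENNReal.ofReal_div_of_pos hk, ← ENNReal.ofReal_div_of_pos hk,
    ← ENNReal.ofReal_add (by positivity) (by positivity), add_div]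

/-- Values of `k` with infinite modular contribute `∞` to the infimum and need not be checked. -/
lemma le_norm_ame (s : F.Ame) {c : ℝ}
    (h : ∀ k : ℝ, 0 < k → F (k • s.val) ≠ ∞ → c ≤ (1 + (F (k • s.val)).toReal) / k) :
    c ≤ ‖s‖ := by
  rw [norm_ame_def]
  refine (ENNReal.ofReal_le_iff_le_toReal (F.amemiyaE_ne_top s.mem)).1 ?_
  refine le_iInf₂ fun k hk => ?_
  by_cases hF : F (k • s.val) = ∞
  · rw [hF, ENNReal.top_div_of_ne_top ENNReal.ofReal_ne_top, add_top]
    exact le_top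
  · refine (ENNReal.ofReal_le_ofReal (h k hk hF)).trans (le_of_eq ?_)
    rw [add_div, ENNReal.ofReal_add (by positivity) (by positivity),
      ENNReal.ofReal_div_of_pos hk, ENNReal.ofReal_div_of_pos hk, ENNReal.ofReal_one,
      ENNReal.ofReal_toReal hF]

/-- Some `k` satisfies `1 + F(ks) < k`; thus `k > 1`, and convexity gives `F(s) ≤ F(ks)/k ≤ 1`. -/
lemma le_one_of_norm_ame_lt_one {s : F.Ame} (hs : ‖s‖ < 1) : F s.val ≤ 1 := by
  by_contra hcon
  refine absurd hs (not_lt.2 (F.le_norm_ame s fun k hk hF => ?_))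
  rw [le_div_iff₀ hk, one_mul]
  by_contra hlt
  push Not at hlt
  have hk1 : 1 < k := lt_of_le_of_lt (by linarith [ENNReal.toReal_nonneg (a := F (k • s.val))]) hlt
  refine hcon ?_
  have h := F.map_smul_le (inv_nonneg.2 hk.le) (inv_le_one_of_one_le₀ hk1.le) (k • s.val)
  rw [smul_smul, inv_mul_cancel₀ hk.ne', one_smul] at h
  refine h.trans ?_
  rw [← ENNReal.ofReal_toReal hF, ← ENNReal.ofReal_mul (inv_nonneg.2 hk.le)]
  refine ENNReal.ofReal_le_one.2 ?_
  rw [inv_mul_le_iff₀ hk]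
  linarith

lemma luxemburg_le_of_le_one {s : S} {β : ℝ} (hβ : 0 < β) (h : F (β⁻¹ • s) ≤ 1) :
    F.luxemburg s ≤ β := csInf_le (F.luxemburg_bddBelow s) ⟨hβ, h⟩

/-- The modular increases along rays, so every `β` strictly above the infimum is admissible; whether
the infimum is attained does not matter. -/
lemma le_one_of_luxemburg_lt {s : S} (hs : s ∈ F.space) {β : ℝ} (h : F.luxemburg s < β) :
    F (β⁻¹ • s) ≤ 1 := by
  obtain ⟨γ, ⟨hγ, hF⟩, hlt⟩ := (csInf_lt_iff (F.luxemburg_bddBelow s)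
    (F.luxemburg_nonempty hs)).1 h
  exact (F.map_smul_mono (inv_nonneg.2 (hγ.trans hlt).le) (inv_anti₀ hγ hlt.le) s).trans hF

/-- An element of `S` at which all multiples of the modular are finite, as a finite element. -/
def toFinite (s : S) (hs : ∀ α : ℝ, 0 < α → F (α • s) < ∞) : F.finiteElements :=
  ⟨(⟨s, 1, one_pos, hs 1 one_pos⟩ : F.space), hs⟩

@[simp] lemma Ame.val_add (s t : F.Ame) : (s + t).val = s.val + t.val := rfl
@[simp] lemma Ame.val_smul (c : ℝ) (s : F.Ame) : (c • s).val = c • s.val := rfl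
@[simp] lemma Ame.val_zero : (0 : F.Ame).val = 0 := rfl
@[simp] lemma Lux.val_add (s t : F.Lux) : (s + t).val = s.val + t.val := rfl
@[simp] lemma Lux.val_smul (c : ℝ) (s : F.Lux) : (c • s).val = c • s.val := rfl

/-- If every element is finite, the modular has a continuous subgradient at every element. -/
lemma exists_subgradient (h : F.finiteElements = ⊤) (s : F.Ame) :
    ∃ l : StrongDual ℝ F.Ame, ∀ t : F.Ame,
      (F s.val).toReal + l (t - s) ≤ (F t.val).toReal := by
  have hfin : ∀ t : F.Ame, F t.val ≠ ∞ := fun t => by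
    have ht : t ∈ F.finiteElements := h ▸ Submodule.mem_top
    simpa using (ht 1 one_pos).ne
  refine ConvexOn.exists_subgradient (f := fun t : F.Ame => (F t.val).toReal)
    ⟨convex_univ, fun t _ u _ a b ha hb hab => ?_⟩ ⟨1, ?_⟩ s
  · have h1 := F.convex' a b ha hb hab t.val u.val
    have h2 := ENNReal.toReal_mono (ENNReal.add_ne_top.2
      ⟨ENNReal.mul_ne_top ENNReal.ofReal_ne_top (hfin t),
        ENNReal.mul_ne_top ENNReal.ofReal_ne_top (hfin u)⟩) h1
    rwa [ENNReal.toReal_add (ENNReal.mul_ne_top ENNReal.ofReal_ne_top (hfin t))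
      (ENNReal.mul_ne_top ENNReal.ofReal_ne_top (hfin u)), ENNReal.toReal_mul,
      ENNReal.toReal_mul, ENNReal.toReal_ofReal ha, ENNReal.toReal_ofReal hb] at h2
  -- Boundedness above near `0`: the modular is at most `1` on the open unit ball.
  · rw [eventually_map]
    filter_upwards [Metric.ball_mem_nhds (0 : F.Ame) one_pos] with t ht
    have := F.le_one_of_norm_ame_lt_one (by simpa using ht)
    exact ENNReal.toReal_mono ENNReal.one_ne_top this

end ConvexModular
end

/-! ### Young's inequality for `I` and `J`, and `J` as a conjugate over bounded variables. -/

noncomputable section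

namespace MarketSetting

variable {Ω : Type*} [MeasurableSpace Ω] {P : Measure Ω}

lemma abs_smul_le {W Z : Ω →ₘ[P] ℝ} (h : ∀ᵐ ω ∂P, |W ω| ≤ |Z ω|) (k : ℝ) :
    ∀ᵐ ω ∂P, |(k • W : Ω →ₘ[P] ℝ) ω| ≤ |(k • Z : Ω →ₘ[P] ℝ) ω| := by
  filter_upwards [h, AEEqFun.coeFn_smul k W, AEEqFun.coeFn_smul k Z] with ω h h1 h2
  rw [h1, h2, Pi.smul_apply, Pi.smul_apply, smul_eq_mul, smul_eq_mul, abs_mul, abs_mul]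
  gcongr

lemma aestronglyMeasurable_mul (Z X : Ω →ₘ[P] ℝ) :
    AEStronglyMeasurable (fun ω => Z ω * X ω) P :=
  Z.aestronglyMeasurable.mul X.aestronglyMeasurable

lemma coeFn_smul_mul_smul (a b : ℝ) (Z X : Ω →ₘ[P] ℝ) :
    (fun ω => (a • Z : Ω →ₘ[P] ℝ) ω * (b • X : Ω →ₘ[P] ℝ) ω) =ᵐ[P]
      fun ω => (a * b) * (Z ω * X ω) := by
  filter_upwards [AEEqFun.coeFn_smul a Z, AEEqFun.coeFn_smul b X] with ω h1 h2
  rw [h1, h2, Pi.smul_apply, Pi.smul_apply, smul_eq_mul, smul_eq_mul]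
  ring

variable [IsProbabilityMeasure P] (A : MarketSetting P)

lemma modI_le {Y : Set.Iic A.market.T → Ω → ℝ} (hY : Y ∈ A.market.deflators 1) (Z : Ω →ₘ[P] ℝ) :
    A.modI Z ≤ ∫⁻ ω, etaStar A.U (Y ⊤ ω) (Z ω) ∂P := iInf₂_le Y hY

lemma le_modJ {Y : Set.Iic A.market.T → Ω → ℝ} (hY : Y ∈ A.market.deflators 1) (X : Ω →ₘ[P] ℝ) :
    ∫⁻ ω, eta A.U (Y ⊤ ω) (X ω) ∂P ≤ A.modJ X :=
  le_iSup₂ (f := fun Y (_ : Y ∈ A.market.deflators 1) => ∫⁻ ω, eta A.U (Y ⊤ ω) (X ω) ∂P) Y hY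

/-- Bounded random variables are finite elements for `I`. -/
lemma modI_smul_lt_top_of_bounded {Z : Ω →ₘ[P] ℝ} (hZ : ∃ C, ∀ᵐ ω ∂P, |Z ω| ≤ C) (α : ℝ)
    (hα : 0 < α) : A.modI (α • Z) < ∞ := by
  obtain ⟨C, hC⟩ := hZ
  obtain ⟨Y, hY, -, hV⟩ := A.nonempty
  -- A strictly positive bound for `α|Z|`, whatever the sign of `C`; the majorant `c V(Y_T / c)` is
  -- integrable for the good deflator with `β = 1/c`.
  set c := α * (|C| + 1) with hc
  have hc0 : 0 < c := by positivity
  refine (A.modI_le hY _).trans_lt ?_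
  calc ∫⁻ ω, etaStar A.U (Y ⊤ ω) ((α • Z : Ω →ₘ[P] ℝ) ω) ∂P
      ≤ ∫⁻ ω, ENNReal.ofReal c * (conjugateV A.U (c⁻¹ * Y ⊤ ω)).toENNReal ∂P := by
        refine lintegral_mono_ae ?_
        filter_upwards [hC, hY.1 ⊤, AEEqFun.coeFn_smul α Z] with ω h hy hs
        have hle : |(α • Z : Ω →ₘ[P] ℝ) ω| ≤ |c| := by
          rw [hs, Pi.smul_apply, smul_eq_mul, abs_mul, abs_of_pos hα, abs_of_pos hc0, hc]
          gcongr
          linarith [le_abs_self C]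
        refine (etaStar_mono hy hle).trans (le_of_eq ?_)
        rw [etaStar, abs_of_pos hc0, div_eq_inv_mul]
    _ < ∞ := by
        rw [lintegral_const_mul' _ _ ENNReal.ofReal_ne_top]
        exact ENNReal.mul_lt_top ENNReal.ofReal_lt_top (hV _ (inv_pos.2 hc0))

/-- Tested at the strictly positive good deflator, finiteness of `J(X)` excludes infinite
`U⁻¹(|X|)`. The conclusion then serves every deflator, also those that may vanish. -/
lemma ae_inverseU_ne_top {X : Ω →ₘ[P] ℝ} (hX : A.modJ X ≠ ∞) :
    ∀ᵐ ω ∂P, inverseU A.U |X ω| ≠ ∞ := by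
  obtain ⟨Y, hY, hpos, -⟩ := A.nonempty
  have h := ae_lt_top' (A.aemeasurable_eta hY X) ((A.le_modJ hY X).trans_lt hX.lt_top).ne
  filter_upwards [h, hpos] with ω h hy hcon
  rw [eta, hcon, ENNReal.mul_top (ENNReal.ofReal_pos.2 hy).ne'] at h
  exact lt_irrefl _ h

/-- Young's inequality for `I` and `J`. -/
lemma lintegral_abs_mul_le (Z : Ω →ₘ[P] ℝ) {X : Ω →ₘ[P] ℝ} (hX : A.modJ X ≠ ∞) :
    ∫⁻ ω, ENNReal.ofReal (|Z ω| * |X ω|) ∂P ≤ A.modI Z + A.modJ X := by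
  -- The same `Y` is used in both Young terms; its `η`-part is at most `J(X)`, and the infimum over
  -- `Y` then produces `I(Z)`.
  have h : ∀ Y ∈ A.market.deflators 1, ∫⁻ ω, ENNReal.ofReal (|Z ω| * |X ω|) ∂P ≤
      (∫⁻ ω, etaStar A.U (Y ⊤ ω) (Z ω) ∂P) + A.modJ X := by
    intro Y hY
    refine le_trans ?_ (add_le_add_right (A.le_modJ hY X) _)
    rw [← lintegral_add_left' (A.aemeasurable_etaStar hY Z)]
    refine lintegral_mono_ae ?_
    filter_upwards [hY.1 ⊤, A.ae_inverseU_ne_top hX] with ω hy hx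
    exact ofReal_mul_le_etaStar_add_eta hy _ hx
  change _ ≤ (⨅ Y ∈ A.market.deflators 1, ∫⁻ ω, etaStar A.U (Y ⊤ ω) (Z ω) ∂P) + A.modJ X
  simp only [ENNReal.iInf_add]
  exact le_iInf₂ h

lemma lintegral_enorm_mul_le (Z : Ω →ₘ[P] ℝ) {X : Ω →ₘ[P] ℝ} (hX : A.modJ X ≠ ∞) :
    ∫⁻ ω, ‖Z ω * X ω‖ₑ ∂P ≤ A.modI Z + A.modJ X := by
  refine le_of_eq_of_le (lintegral_congr fun ω => ?_) (A.lintegral_abs_mul_le Z hX)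
  rw [← ofReal_norm, Real.norm_eq_abs, abs_mul]

lemma integrable_mul {Z X : Ω →ₘ[P] ℝ} (hZ : Z ∈ A.modI.space) (hX : X ∈ A.modJ.space) :
    Integrable (fun ω => Z ω * X ω) P := by
  obtain ⟨a, ha, hZ⟩ := hZ
  obtain ⟨b, hb, hX⟩ := hX
  have h : Integrable (fun ω => (a • Z : Ω →ₘ[P] ℝ) ω * (b • X : Ω →ₘ[P] ℝ) ω) P :=
    ⟨aestronglyMeasurable_mul _ _, (A.lintegral_enorm_mul_le _ hX.ne).trans_lt
      (ENNReal.add_lt_top.2 ⟨hZ, hX⟩)⟩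
  have h' := (h.congr (coeFn_smul_mul_smul a b Z X)).const_mul (a * b)⁻¹
  refine h'.congr (ae_of_all _ fun ω => ?_)
  simp only
  rw [← mul_assoc, inv_mul_cancel₀ (mul_pos ha hb).ne', one_mul]

lemma abs_integral_mul_le {Z X : Ω →ₘ[P] ℝ} (hZ : A.modI Z ≠ ∞) (hX : A.modJ X ≠ ∞) :
    |∫ ω, Z ω * X ω ∂P| ≤ (A.modI Z).toReal + (A.modJ X).toReal := by
  rw [← ENNReal.toReal_add hZ hX, ← Real.norm_eq_abs]
  refine (norm_integral_le_lintegral_norm _).trans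
    (ENNReal.toReal_mono (ENNReal.add_ne_top.2 ⟨hZ, hX⟩) ?_)
  simpa only [ofReal_norm] using A.lintegral_enorm_mul_le Z hX

/-- `J` is dominated by the conjugate of `I` over the bounded random variables. -/
lemma modJ_le_of_forall_bounded {X : Ω →ₘ[P] ℝ} {c : ℝ≥0∞}
    (h : ∀ Z : Ω →ₘ[P] ℝ, (∃ C, ∀ᵐ ω ∂P, |Z ω| ≤ C) → (∀ᵐ ω ∂P, 0 ≤ Z ω * X ω) →
      ∫⁻ ω, ENNReal.ofReal (Z ω * X ω) ∂P ≤ c + A.modI Z) : A.modJ X ≤ c := by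
  refine iSup₂_le fun Y hY => ?_
  have hYm := A.aemeasurable_terminal hY
  have hXm : AEMeasurable X P := X.aestronglyMeasurable.aemeasurable
  have hm : ∀ n : ℕ, AEMeasurable (fun ω => ENNReal.ofReal (if Y ⊤ ω ≤ n then Y ⊤ ω else 0) *
      min (inverseU A.U |X ω|) n) P := fun n => by
    refine AEMeasurable.mul ?_ (AEMeasurable.min
      ((measurable_inverseU_abs A.U).comp_aemeasurable hXm) aemeasurable_const)
    have : Measurable fun y : ℝ => ENNReal.ofReal (if y ≤ n then y else 0) :=
      (Measurable.ite measurableSet_Iic measurable_id measurable_const).ennreal_ofReal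
    exact this.comp_aemeasurable hYm
  -- Monotone convergence reduces the claim to the truncations of `η`, for which a bounded
  -- near-maximizer exists.
  simp only [← iSup_truncated_eta]
  rw [lintegral_iSup' hm (ae_of_all _ fun ω => monotone_truncated_eta _ _ _)]
  refine iSup_le fun n => ?_
  rcases Nat.eq_zero_or_pos n with rfl | hn
  · simp
  have hZm : AEStronglyMeasurable (fun ω => nearMaximizer A.U n (Y ⊤ ω) (X ω)) P :=
    ((measurable_nearMaximizer A.U n).comp_aemeasurable (hYm.prodMk hXm)).aestronglyMeasurable
  set Z : Ω →ₘ[P] ℝ := AEEqFun.mk _ hZm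
  have hZ : Z =ᵐ[P] fun ω => nearMaximizer A.U n (Y ⊤ ω) (X ω) := AEEqFun.coeFn_mk _ hZm
  have h1 := h Z ⟨n / deriv A.U n, by
    filter_upwards [hZ] with ω hω
    rw [hω]
    exact abs_nearMaximizer_le A.utility hn _ _⟩ (by
    filter_upwards [hZ] with ω hω
    rw [hω]
    exact nearMaximizer_mul_nonneg A.utility hn _ _)
  have hfin : ∫⁻ ω, etaStar A.U (Y ⊤ ω) (Z ω) ∂P ≠ ∞ := by
    refine ne_top_of_le_ne_top (b := ∫⁻ _, ENNReal.ofReal (n / deriv A.U n * A.U n) ∂P)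
      (by simp) (lintegral_mono_ae ?_)
    filter_upwards [hZ, hY.1 ⊤] with ω hω hy
    rw [hω]
    exact (etaStar_nearMaximizer_le A.utility hn hy).1
  -- Adding the finite `E[η*_Y(Z)]` to both sides, it remains to use `E[ZX] ≤ c + I(Z)` and `I(Z) ≤
  -- E[η*_Y(Z)]` for this very `Y`.
  refine (ENNReal.add_le_add_iff_right hfin).1 ?_
  refine le_trans ?_ (h1.trans (add_le_add_right (A.modI_le hY Z) _))
  rw [← lintegral_add_left' (hm n)]
  refine lintegral_mono_ae ?_
  filter_upwards [hZ, hY.1 ⊤] with ω hω hy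
  rw [hω]
  exact (etaStar_nearMaximizer_le A.utility hn hy).2

end MarketSetting
end

/-! ### Order continuity of the norm on `E_I` and Radon–Nikodym densities of functionals. -/

noncomputable section

namespace MarketSetting

variable {Ω : Type*} [MeasurableSpace Ω] {P : Measure Ω} [IsProbabilityMeasure P]
variable (A : MarketSetting P)

/-- The Amemiya norm of `I` is order continuous on the finite elements. -/
lemma tendsto_norm_zero {ι : Type*} [Countable ι] {L : Filter ι} [L.IsCountablyGenerated]
    {W : ι → A.modI.Ame} {Z : A.modI.finiteElements}
    (hle : ∀ i, ∀ᵐ ω ∂P, |(W i).val ω| ≤ |Z.1.val ω|)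
    (hlim : ∀ᵐ ω ∂P, Tendsto (fun i => (W i).val ω) L (𝓝 0)) :
    Tendsto (fun i => ‖W i‖) L (𝓝 0) := by
  refine tendsto_order.2 ⟨fun a ha => Eventually.of_forall fun i => ha.trans_le (norm_nonneg _),
    fun ε hε => ?_⟩
  -- Once `I(k W) ≤ 1`, the Amemiya norm is at most `2 / k = 2ε/3 < ε`.
  set k : ℝ := 3 / ε with hk
  have hk0 : 0 < k := by positivity
  have hfin := Z.2 k hk0
  -- One deflator with finite integral at `kZ` provides the dominating function, and bounds `I(k W)`
  -- for all indices at once.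
  obtain ⟨Y, hY, hYfin⟩ : ∃ Y ∈ A.market.deflators 1,
      ∫⁻ ω, etaStar A.U (Y ⊤ ω) ((k • Z.1.val : Ω →ₘ[P] ℝ) ω) ∂P < ∞ := by
    simpa only [iInf_lt_iff, exists_prop] using show (⨅ Y ∈ A.market.deflators 1,
      ∫⁻ ω, etaStar A.U (Y ⊤ ω) ((k • Z.1.val : Ω →ₘ[P] ℝ) ω) ∂P) < ∞ from hfin
  have hsm : ∀ i, ∀ᵐ ω ∂P, (k • (W i).val : Ω →ₘ[P] ℝ) ω = k * (W i).val ω := fun i => by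
    filter_upwards [AEEqFun.coeFn_smul k (W i).val] with ω h
    simpa using h
  have hT : Tendsto (fun i => ∫⁻ ω, etaStar A.U (Y ⊤ ω) (k * (W i).val ω) ∂P) L
      (𝓝 (∫⁻ _, 0 ∂P)) := by
    refine tendsto_lintegral_filter_of_dominated_convergence'
      (fun ω => etaStar A.U (Y ⊤ ω) ((k • Z.1.val : Ω →ₘ[P] ℝ) ω)) ?_ ?_ hYfin.ne ?_
    · refine Eventually.of_forall fun i => (A.aemeasurable_etaStar hY (k • (W i).val)).congr ?_
      filter_upwards [hsm i] with ω h
      rw [h]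
    · refine Eventually.of_forall fun i => ?_
      filter_upwards [abs_smul_le (hle i) k, hY.1 ⊤, hsm i] with ω h hy hs
      rw [← hs]
      exact etaStar_mono hy h
    · filter_upwards [hlim, ae_all_iff.2 hle, hY.1 ⊤, AEEqFun.coeFn_smul k Z.1.val,
        ae_lt_top' (A.aemeasurable_etaStar hY _) hYfin.ne] with ω hlim hle hy hs hfin
      rw [hs, Pi.smul_apply, smul_eq_mul] at hfin
      rcases eq_or_ne (Z.1.val ω) 0 with h0 | h0
      · have : ∀ i, (W i).val ω = 0 := fun i => by simpa [h0] using hle i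
        simpa only [this, mul_zero, etaStar_zero] using tendsto_const_nhds
      -- With this finite factor frozen at `kZ`, `η*(kW)` is at most `|kW|` times a constant, which
      -- tends to `0`.
      have hV : (conjugateV A.U (Y ⊤ ω / |k * Z.1.val ω|)).toENNReal ≠ ∞ := fun hcon => by
        rw [etaStar, hcon, ENNReal.mul_top] at hfin
        · exact lt_irrefl _ hfin
        · exact (ENNReal.ofReal_pos.2 (abs_pos.2 (mul_ne_zero hk0.ne' h0))).ne'
      refine tendsto_of_tendsto_of_tendsto_of_le_of_le tendsto_const_nhds
        (h := fun i => ENNReal.ofReal |k * (W i).val ω| *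
          (conjugateV A.U (Y ⊤ ω / |k * Z.1.val ω|)).toENNReal) ?_ (fun i => bot_le)
        (fun i => etaStar_le_mul hy ?_)
      · have h1 := ENNReal.tendsto_ofReal (hlim.const_mul k).abs
        simpa using ENNReal.Tendsto.mul_const h1 (Or.inr hV)
      · rw [abs_mul, abs_mul]
        exact mul_le_mul_of_nonneg_left (hle i) (abs_nonneg k)
  rw [lintegral_zero] at hT
  filter_upwards [hT.eventually (gt_mem_nhds (one_pos : (0 : ℝ≥0∞) < 1))] with i hi
  have h1 : A.modI (k • (W i).val) ≤ ENNReal.ofReal 1 := by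
    rw [ENNReal.ofReal_one]
    refine (A.modI_le hY _).trans (le_of_eq_of_le (lintegral_congr_ae ?_) hi.le)
    filter_upwards [hsm i] with ω h
    rw [h]
  refine (A.modI.norm_ame_le (W i) hk0 zero_le_one h1).trans_lt ?_
  rw [hk]
  field_simp
  norm_num

/-- The finite element of a bounded measurable function. -/
def ofBounded (f : Ω → ℝ) (hf : Measurable f) (hb : ∃ C, ∀ ω, |f ω| ≤ C) :
    A.modI.finiteElements :=
  A.modI.toFinite (AEEqFun.mk f hf.aestronglyMeasurable) <|
    A.modI_smul_lt_top_of_bounded <| hb.imp fun C h => by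
      filter_upwards [AEEqFun.coeFn_mk f hf.aestronglyMeasurable (μ := P)] with ω hω
      rw [hω]
      exact h ω

lemma coeFn_ofBounded (f : Ω → ℝ) (hf : Measurable f) (hb : ∃ C, ∀ ω, |f ω| ≤ C) :
    (A.ofBounded f hf hb).1.val =ᵐ[P] f :=
  AEEqFun.coeFn_mk f _

lemma _root_.MeasureTheory.SimpleFunc.exists_abs_le (f : SimpleFunc Ω ℝ) :
    ∃ C, ∀ ω, |f ω| ≤ C := f.exists_forall_norm_le

/-- The finite element of a simple function. -/
def ofSimple (f : SimpleFunc Ω ℝ) : A.modI.finiteElements :=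
  A.ofBounded f f.measurable f.exists_abs_le

lemma coeFn_ofSimple (f : SimpleFunc Ω ℝ) : (A.ofSimple f).1.val =ᵐ[P] f :=
  A.coeFn_ofBounded _ _ _

lemma finite_ext {Z W : A.modI.finiteElements} (h : Z.1.val =ᵐ[P] W.1.val) : Z = W :=
  Subtype.ext (Subtype.ext (AEEqFun.ext h))

/-- Simple functions are dense among the finite elements, with domination. -/
lemma exists_simple_tendsto (Z : A.modI.finiteElements) :
    ∃ s : ℕ → SimpleFunc Ω ℝ, (∀ n, ∀ᵐ ω ∂P, |s n ω| ≤ 2 * |Z.1.val ω|) ∧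
      (∀ᵐ ω ∂P, Tendsto (fun n => s n ω) atTop (𝓝 (Z.1.val ω))) ∧
      Tendsto (fun n => A.ofSimple (s n)) atTop (𝓝 Z) := by
  obtain ⟨g, hg, hgZ⟩ := Z.1.val.aestronglyMeasurable.aemeasurable
  set s : ℕ → SimpleFunc Ω ℝ := fun n =>
    SimpleFunc.approxOn g hg Set.univ 0 (Set.mem_univ _) n
  have hs1 : ∀ n, ∀ᵐ ω ∂P, |s n ω| ≤ 2 * |Z.1.val ω| := fun n => by
    filter_upwards [hgZ] with ω h
    have := SimpleFunc.norm_approxOn_zero_le hg (Set.mem_univ 0) ω n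
    rw [h, two_mul]
    simpa only [Real.norm_eq_abs] using this
  have hs2 : ∀ᵐ ω ∂P, Tendsto (fun n => s n ω) atTop (𝓝 (Z.1.val ω)) := by
    filter_upwards [hgZ] with ω h
    rw [h]
    exact SimpleFunc.tendsto_approxOn hg _ (by simp)
  refine ⟨s, hs1, hs2, ?_⟩
  have hsub : ∀ n, ∀ᵐ ω ∂P, (A.ofSimple (s n) - Z).1.val ω = s n ω - Z.1.val ω := fun n => by
    filter_upwards [AEEqFun.coeFn_sub (A.ofSimple (s n)).1.val Z.1.val, A.coeFn_ofSimple (s n)]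
      with ω h1 h2
    rw [← h2]
    exact h1
  rw [tendsto_iff_norm_sub_tendsto_zero]
  -- The dominating element is `3Z`, since `|s n - Z| ≤ 2|Z| + |Z|`.
  refine A.tendsto_norm_zero (W := fun n => (A.ofSimple (s n) - Z).1) (Z := (3 : ℝ) • Z)
    (fun n => ?_) ?_
  · filter_upwards [hsub n, hs1 n, AEEqFun.coeFn_smul (3 : ℝ) Z.1.val] with ω h1 h2 h3
    rw [h1, show ((3 : ℝ) • Z).1.val ω = 3 * Z.1.val ω from h3, abs_mul]
    refine (abs_sub _ _).trans ?_
    rw [abs_of_pos (by norm_num : (0 : ℝ) < 3)]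
    linarith
  · filter_upwards [ae_all_iff.2 hsub, hs2] with ω h1 h2
    simp only [h1]
    simpa using h2.sub_const (Z.1.val ω)

/-- The indicator of a measurable set as a finite element. -/
def indicatorElement {B : Set Ω} (hB : MeasurableSet B) : A.modI.finiteElements :=
  A.ofBounded (B.indicator 1) (measurable_one.indicator hB)
    ⟨1, fun ω => by by_cases h : ω ∈ B <;> simp [h]⟩

lemma coeFn_indicatorElement {B : Set Ω} (hB : MeasurableSet B) :
    (A.indicatorElement hB).1.val =ᵐ[P] B.indicator 1 :=
  A.coeFn_ofBounded _ _ _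

lemma coeFn_sum_finite {ι : Type*} (s : Finset ι) (Z : ι → A.modI.finiteElements)
    (g : ι → Ω → ℝ) (h : ∀ i, (Z i).1.val =ᵐ[P] g i) :
    (∑ i ∈ s, Z i).1.val =ᵐ[P] fun ω => ∑ i ∈ s, g i ω := by
  classical
  induction s using Finset.induction_on with
  | empty =>
    filter_upwards [AEEqFun.coeFn_zero (α := Ω) (β := ℝ) (μ := P)] with ω hω
    rw [Finset.sum_empty]
    exact hω
  | insert a s ha ih =>
    filter_upwards [AEEqFun.coeFn_add (Z a).1.val (∑ i ∈ s, Z i).1.val, h a, ih] with ω h1 h2 h3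
    rw [Finset.sum_insert ha, Finset.sum_insert ha, ← h2, ← h3]
    exact h1

/-- The error of a finite partial sum is bounded by `1`, and at each point it vanishes once the
finite set contains the index of the piece holding that point. Order continuity applies along the
countably generated filter of finite subsets of `ℕ`; this is the countable additivity of `B ↦
l(1_B)`. -/
lemma hasSum_indicatorElement {f : ℕ → Set Ω} (hf : ∀ i, MeasurableSet (f i))
    (hd : Pairwise (Function.onFun Disjoint f)) :
    HasSum (fun i => A.indicatorElement (hf i)) (A.indicatorElement (MeasurableSet.iUnion hf)) := by
  rw [HasSum, SummationFilter.unconditional_filter, tendsto_iff_norm_sub_tendsto_zero]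
  have hsub : ∀ s : Finset ℕ, ∀ᵐ ω ∂P,
      (∑ i ∈ s, A.indicatorElement (hf i) - A.indicatorElement (MeasurableSet.iUnion hf)).1.val ω =
        ∑ i ∈ s, (f i).indicator 1 ω - (⋃ i, f i).indicator 1 ω := fun s => by
    filter_upwards [AEEqFun.coeFn_sub (∑ i ∈ s, A.indicatorElement (hf i)).1.val
      (A.indicatorElement (MeasurableSet.iUnion hf)).1.val,
      A.coeFn_sum_finite s _ _ fun i => A.coeFn_indicatorElement (hf i),
      A.coeFn_indicatorElement (MeasurableSet.iUnion hf)] with ω h1 h2 h3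
    rw [← h2, ← h3]
    exact h1
  have hval : ∀ (ω : Ω) (i : ℕ), ω ∈ f i → ∀ s : Finset ℕ,
      ∑ j ∈ s, (f j).indicator (1 : Ω → ℝ) ω - (⋃ j, f j).indicator 1 ω =
        if i ∈ s then 0 else -1 := by
    intro ω i hi s
    have h1 : ∀ j, (f j).indicator (1 : Ω → ℝ) ω = if i = j then 1 else 0 := fun j => by
      rcases eq_or_ne i j with rfl | hij
      · simp [hi]
      · simp [hij, Set.disjoint_left.1 (hd hij) hi]
    have h2 : ω ∈ ⋃ j, f j := Set.mem_iUnion.2 ⟨i, hi⟩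
    simp only [h1, Finset.sum_ite_eq, Set.indicator_of_mem h2, Pi.one_apply]
    split_ifs <;> norm_num
  have hval' : ∀ ω : Ω, ω ∉ ⋃ j, f j → ∀ s : Finset ℕ,
      ∑ j ∈ s, (f j).indicator (1 : Ω → ℝ) ω - (⋃ j, f j).indicator 1 ω = 0 := by
    intro ω hω s
    have h1 : ∀ j, ω ∉ f j := by simpa using hω
    simp [h1]
  refine A.tendsto_norm_zero (W := fun s : Finset ℕ => (∑ i ∈ s, A.indicatorElement (hf i) -
    A.indicatorElement (MeasurableSet.iUnion hf)).1)
    (Z := A.indicatorElement MeasurableSet.univ) (fun s => ?_) ?_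
  · filter_upwards [hsub s, A.coeFn_indicatorElement MeasurableSet.univ] with ω h1 h2
    rw [h1, h2, Set.indicator_univ, Pi.one_apply, abs_one]
    by_cases hω : ω ∈ ⋃ j, f j
    · obtain ⟨i, hi⟩ := Set.mem_iUnion.1 hω
      rw [hval ω i hi]
      split_ifs <;> norm_num
    · rw [hval' ω hω]
      norm_num
  · filter_upwards [ae_all_iff.2 hsub] with ω h
    simp only [h]
    by_cases hω : ω ∈ ⋃ j, f j
    · obtain ⟨i, hi⟩ := Set.mem_iUnion.1 hω
      refine tendsto_const_nhds.congr' ?_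
      filter_upwards [eventually_ge_atTop ({i} : Finset ℕ)] with s hs
      rw [hval ω i hi, if_pos (hs (Finset.mem_singleton_self i))]
    · simp only [hval' ω hω]
      exact tendsto_const_nhds

/-- The signed measure `B ↦ l(1_B)` of a continuous functional on the finite elements. -/
def toSignedMeasure (l : StrongDual ℝ A.modI.finiteElements) : SignedMeasure Ω where
  measureOf' B := open Classical in
    if h : MeasurableSet B then l (A.indicatorElement h) else 0
  empty' := by
    rw [dif_pos MeasurableSet.empty, ← map_zero l]
    congr 1
    refine A.finite_ext ?_
    filter_upwards [A.coeFn_indicatorElement MeasurableSet.empty,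
      AEEqFun.coeFn_zero (α := Ω) (β := ℝ) (μ := P)] with ω h1 h2
    rw [h1, Set.indicator_empty]
    exact h2.symm
  not_measurable' B hB := dif_neg hB
  m_iUnion' f hf hd := by
    simp only [hf, MeasurableSet.iUnion hf, dif_pos]
    exact (A.hasSum_indicatorElement hf hd).mapL l

lemma toSignedMeasure_apply (l : StrongDual ℝ A.modI.finiteElements) {B : Set Ω}
    (hB : MeasurableSet B) : A.toSignedMeasure l B = l (A.indicatorElement hB) := dif_pos hB

/-- A continuous functional on the finite elements has an integrable density on the simple
functions. -/
lemma exists_integrable_density (l : StrongDual ℝ A.modI.finiteElements) :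
    ∃ X : Ω →ₘ[P] ℝ, Integrable X P ∧
      ∀ s : SimpleFunc Ω ℝ, l (A.ofSimple s) = ∫ ω, s ω * X ω ∂P := by
  -- The indicator of a null set is the zero element of `E_I`.
  have hac : A.toSignedMeasure l ≪ᵥ P.toENNRealVectorMeasure := by
    refine VectorMeasure.AbsolutelyContinuous.mk fun B hB h0 => ?_
    rw [Measure.toENNRealVectorMeasure_apply_measurable hB] at h0
    rw [A.toSignedMeasure_apply l hB, ← map_zero l]
    congr 1
    refine A.finite_ext ?_
    filter_upwards [A.coeFn_indicatorElement hB, measure_eq_zero_iff_ae_notMem.1 h0,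
      AEEqFun.coeFn_zero (α := Ω) (β := ℝ) (μ := P)] with ω h1 h2 h3
    rw [h1, Set.indicator_of_notMem h2]
    exact h3.symm
  have hX : Integrable ((A.toSignedMeasure l).rnDeriv P) P :=
    SignedMeasure.integrable_rnDeriv _ _
  set X : Ω →ₘ[P] ℝ := AEEqFun.mk _ hX.1
  have hXX : X =ᵐ[P] (A.toSignedMeasure l).rnDeriv P := AEEqFun.coeFn_mk _ hX.1
  have hXi : Integrable X P := hX.congr hXX.symm
  have hset : ∀ {B : Set Ω} (hB : MeasurableSet B),
      l (A.indicatorElement hB) = ∫ ω in B, X ω ∂P := fun {B} hB => by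
    rw [← A.toSignedMeasure_apply l hB, ← SignedMeasure.withDensityᵥ_rnDeriv_eq _ P hac,
      withDensityᵥ_apply hX hB]
    exact integral_congr_ae (ae_restrict_of_ae hXX.symm)
  refine ⟨X, hXi, fun s => ?_⟩
  induction s using SimpleFunc.induction with
  | @const c B hB =>
    have e : A.ofSimple (SimpleFunc.piecewise B hB (SimpleFunc.const Ω c) (SimpleFunc.const Ω 0))
        = c • A.indicatorElement hB := by
      refine A.finite_ext ?_
      filter_upwards [A.coeFn_ofSimple (SimpleFunc.piecewise B hB (SimpleFunc.const Ω c)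
        (SimpleFunc.const Ω 0)), A.coeFn_indicatorElement hB,
        AEEqFun.coeFn_smul c (A.indicatorElement hB).1.val] with ω h1 h2 h3
      rw [h1, show (c • A.indicatorElement hB).1.val ω = c * (A.indicatorElement hB).1.val ω
        from h3, h2]
      by_cases hω : ω ∈ B <;> simp [hω]
    rw [e, map_smul, hset hB, smul_eq_mul, ← integral_const_mul, ← integral_indicator hB]
    refine integral_congr_ae (ae_of_all _ fun ω => ?_)
    by_cases hω : ω ∈ B <;> simp [hω]
  | @add f g _ hf hg =>
    have e : A.ofSimple (f + g) = A.ofSimple f + A.ofSimple g := by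
      refine A.finite_ext ?_
      filter_upwards [A.coeFn_ofSimple (f + g), A.coeFn_ofSimple f, A.coeFn_ofSimple g,
        AEEqFun.coeFn_add (A.ofSimple f).1.val (A.ofSimple g).1.val] with ω h1 h2 h3 h4
      rw [h1, show (A.ofSimple f + A.ofSimple g).1.val ω = _ from h4, Pi.add_apply, h2, h3]
      rfl
    obtain ⟨Cf, hCf⟩ := f.exists_abs_le
    obtain ⟨Cg, hCg⟩ := g.exists_abs_le
    rw [e, map_add, hf, hg, ← integral_add
      (hXi.bdd_mul f.aestronglyMeasurable (ae_of_all _ hCf))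
      (hXi.bdd_mul g.aestronglyMeasurable (ae_of_all _ hCg))]
    refine integral_congr_ae (ae_of_all _ fun ω => ?_)
    simp [add_mul]

/-- The density also represents the functional on bounded random variables. -/
lemma apply_eq_integral_of_bounded {l : StrongDual ℝ A.modI.finiteElements} {X : Ω →ₘ[P] ℝ}
    (hX : Integrable X P) (h : ∀ s : SimpleFunc Ω ℝ, l (A.ofSimple s) = ∫ ω, s ω * X ω ∂P)
    (Z : A.modI.finiteElements) (hZ : ∃ C, ∀ᵐ ω ∂P, |Z.1.val ω| ≤ C) :
    l Z = ∫ ω, Z.1.val ω * X ω ∂P := by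
  obtain ⟨C, hC⟩ := hZ
  obtain ⟨s, hs1, hs2, hs3⟩ := A.exists_simple_tendsto Z
  refine tendsto_nhds_unique ((l.continuous.tendsto Z).comp hs3) ?_
  simp only [Function.comp_def, h]
  -- Only integrability of `X` is available at this stage, so the bound on `Z` has to supply the
  -- majorant.
  refine tendsto_integral_of_dominated_convergence (fun ω => 2 * C * |X ω|)
    (fun n => (s n).aestronglyMeasurable.mul hX.1) (hX.abs.const_mul _) (fun n => ?_) ?_
  · filter_upwards [hs1 n, hC] with ω h1 h2
    rw [Real.norm_eq_abs, abs_mul]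
    gcongr
    linarith
  · filter_upwards [hs2] with ω hω
    exact hω.mul_const _

end MarketSetting
end

/-! ### The pairing, the isometry onto the dual, and the conjugates. -/

noncomputable section

/-- If `b = ∞` the left side is `⊥`, and if `c = ∞` the right side is `⊤`; only the finite case
carries content. -/
lemma EReal.coe_sub_coe_ennreal_le {a : ℝ} {b c : ℝ≥0∞}
    (h : b ≠ ∞ → c ≠ ∞ → a ≤ b.toReal + c.toReal) : (a : EReal) - (b : EReal) ≤ (c : EReal) := by
  by_cases hb : b = ∞
  · simp [hb]
  by_cases hc : c = ∞
  · simp [hc]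
  rw [← EReal.coe_ennreal_toReal hb, ← EReal.coe_ennreal_toReal hc, ← EReal.coe_sub,
    EReal.coe_le_coe_iff]
  linarith [h hb hc]

namespace MarketSetting

variable {Ω : Type*} [MeasurableSpace Ω] {P : Measure Ω} [IsProbabilityMeasure P]
variable (A : MarketSetting P)

/-- Young's inequality for `kZ` and `X/β` reads `(k/β) |E[ZX]| ≤ I(kZ) + 1`; the infimum over `k` is
the Amemiya norm. -/
lemma abs_integral_mul_le_of_modJ_le_one (Z : A.modI.Ame) {X : Ω →ₘ[P] ℝ} {β : ℝ} (hβ : 0 < β)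
    (hX : A.modJ (β⁻¹ • X) ≤ 1) : |∫ ω, Z.val ω * X ω ∂P| ≤ β * ‖Z‖ := by
  rw [← div_le_iff₀' hβ]
  refine A.modI.le_norm_ame Z fun k hk hI => ?_
  have h := A.abs_integral_mul_le hI (ne_top_of_le_ne_top ENNReal.one_ne_top hX)
  rw [integral_congr_ae (coeFn_smul_mul_smul k β⁻¹ Z.val X), integral_const_mul, abs_mul,
    abs_of_pos (mul_pos hk (inv_pos.2 hβ))] at h
  have h1 : (A.modJ (β⁻¹ • X)).toReal ≤ 1 := ENNReal.toReal_mono ENNReal.one_ne_top hX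
  rw [le_div_iff₀ hk]
  calc |∫ ω, Z.val ω * X ω ∂P| / β * k = k * β⁻¹ * |∫ ω, Z.val ω * X ω ∂P| := by
        rw [div_eq_mul_inv]; ring
    _ ≤ _ := by linarith

/-- Hölder's inequality for the Luxemburg and the Amemiya norm. -/
lemma abs_integral_mul_le_norm (Z : A.modI.Ame) (X : A.modJ.Lux) :
    |∫ ω, Z.val ω * X.val ω ∂P| ≤ ‖X‖ * ‖Z‖ := by
  -- Taking `β` strictly above the norm and letting it decrease avoids both attainment and the case
  -- `‖X‖ = 0`.
  have h : ∀ β ∈ Set.Ioi ‖X‖, |∫ ω, Z.val ω * X.val ω ∂P| ≤ β * ‖Z‖ := fun β hβ =>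
    A.abs_integral_mul_le_of_modJ_le_one Z ((norm_nonneg X).trans_lt hβ)
      (A.modJ.le_one_of_luxemburg_lt X.mem hβ)
  have ht : Tendsto (fun β => β * ‖Z‖) (𝓝[>] ‖X‖) (𝓝 (‖X‖ * ‖Z‖)) :=
    ((by fun_prop : Continuous fun β : ℝ => β * ‖Z‖).tendsto _).mono_left nhdsWithin_le_nhds
  exact ge_of_tendsto ht (by filter_upwards [self_mem_nhdsWithin] with β hβ using h β hβ)

/-- The bilinear pairing `(X, Z) ↦ E[Z X]`. -/
def pairing : A.modJ.Lux →ₗ[ℝ] A.modI.Ame →ₗ[ℝ] ℝ :=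
  LinearMap.mk₂ ℝ (fun X Z => ∫ ω, Z.val ω * X.val ω ∂P)
    (fun X X' Z => by
      rw [← integral_add (A.integrable_mul Z.mem X.mem) (A.integrable_mul Z.mem X'.mem)]
      refine integral_congr_ae ?_
      filter_upwards [AEEqFun.coeFn_add X.val X'.val] with ω h
      rw [ConvexModular.Lux.val_add, h, Pi.add_apply, mul_add])
    (fun c X Z => by
      rw [smul_eq_mul, ← integral_const_mul]
      refine integral_congr_ae ?_
      filter_upwards [AEEqFun.coeFn_smul c X.val] with ω h
      rw [ConvexModular.Lux.val_smul, h, Pi.smul_apply, smul_eq_mul]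
      ring)
    (fun X Z Z' => by
      rw [← integral_add (A.integrable_mul Z.mem X.mem) (A.integrable_mul Z'.mem X.mem)]
      refine integral_congr_ae ?_
      filter_upwards [AEEqFun.coeFn_add Z.val Z'.val] with ω h
      rw [ConvexModular.Ame.val_add, h, Pi.add_apply, add_mul])
    (fun c X Z => by
      rw [smul_eq_mul, ← integral_const_mul]
      refine integral_congr_ae ?_
      filter_upwards [AEEqFun.coeFn_smul c Z.val] with ω h
      rw [ConvexModular.Ame.val_smul, h, Pi.smul_apply, smul_eq_mul]
      ring)

/-- The continuous functional `E[· X]` on `L_I`. -/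
def dualOfLux (X : A.modJ.Lux) : StrongDual ℝ A.modI.Ame :=
  (A.pairing X).mkContinuous ‖X‖ fun Z => A.abs_integral_mul_le_norm Z X

/-- The continuous functional `E[· Z]` on `L_J`. -/
def dualOfAme (Z : A.modI.Ame) : StrongDual ℝ A.modJ.Lux :=
  (A.pairing.flip Z).mkContinuous ‖Z‖ fun X =>
    (A.abs_integral_mul_le_norm Z X).trans_eq (mul_comm _ _)

lemma integral_mul_le (Z : A.modI.Ame) (X : A.modJ.Lux) (hI : A.modI Z.val ≠ ∞)
    (hJ : A.modJ X.val ≠ ∞) :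
    ∫ ω, Z.val ω * X.val ω ∂P ≤ (A.modI Z.val).toReal + (A.modJ X.val).toReal :=
  (le_abs_self _).trans (A.abs_integral_mul_le hI hJ)

/-- The conjugate of `I` is `J`. -/
lemma conjAme_dualOfLux (X : A.modJ.Lux) :
    A.modI.conjAme (A.dualOfLux X) = (A.modJ X.val : EReal) := by
  refine le_antisymm (iSup_le fun Z =>
    EReal.coe_sub_coe_ennreal_le fun hI hJ => A.integral_mul_le Z X hI hJ) ?_
  have hle := fun Z => le_iSup (fun Z : A.modI.Ame =>
    ((A.dualOfLux X Z : ℝ) : EReal) - (A.modI Z.val : EReal)) Z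
  -- Testing with `Z = 0` makes the conjugate nonnegative, so it can serve as the `ℝ≥0∞` constant in
  -- `modJ_le_of_forall_bounded`.
  have h0 : (0 : EReal) ≤ A.modI.conjAme (A.dualOfLux X) := by
    refine le_trans (le_of_eq ?_) (hle 0)
    simp [A.modI.map_zero']
  rw [← EReal.coe_toENNReal h0, EReal.coe_ennreal_le_coe_ennreal_iff]
  refine A.modJ_le_of_forall_bounded fun Z hZ hpos => ?_
  have hfin := A.modI_smul_lt_top_of_bounded hZ
  set Z' := (A.modI.toFinite Z hfin).1
  have hI : A.modI Z ≠ ∞ := by simpa using (hfin 1 one_pos).ne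
  have hint : Integrable (fun ω => Z ω * X.val ω) P := A.integrable_mul Z'.mem X.mem
  rw [← ofReal_integral_eq_lintegral_ofReal hint hpos, ← EReal.coe_ennreal_le_coe_ennreal_iff, EReal.coe_ennreal_add, EReal.coe_toENNReal h0,
    EReal.coe_ennreal_ofReal, max_eq_left (integral_nonneg_of_ae hpos),
    ← EReal.sub_le_iff_le_add (Or.inl (by simp)) (Or.inl (by simpa using hI))]
  exact hle Z'

/-- A functional with density `X` on the bounded random variables bounds `J` at `X`. -/
lemma modJ_le_one_of_norm_le {l : StrongDual ℝ A.modI.finiteElements} {X : Ω →ₘ[P] ℝ}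
    (hX : Integrable X P) (hl : ∀ Z : A.modI.finiteElements, (∃ C, ∀ᵐ ω ∂P, |Z.1.val ω| ≤ C) →
      l Z = ∫ ω, Z.1.val ω * X ω ∂P) {β : ℝ} (hβ : 0 < β) (h : ‖l‖ ≤ β) :
    A.modJ (β⁻¹ • X) ≤ 1 := by
  refine A.modJ_le_of_forall_bounded fun Z hZ hpos => ?_
  have hfin := A.modI_smul_lt_top_of_bounded hZ
  set Z' := A.modI.toFinite Z hfin with hZ'
  have hI : A.modI Z ≠ ∞ := by simpa using (hfin 1 one_pos).ne
  have hae : (fun ω => Z ω * (β⁻¹ • X : Ω →ₘ[P] ℝ) ω) =ᵐ[P] fun ω => β⁻¹ * (Z ω * X ω) := by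
    filter_upwards [AEEqFun.coeFn_smul β⁻¹ X] with ω h
    rw [h, Pi.smul_apply, smul_eq_mul]
    ring
  have hint : Integrable (fun ω => Z ω * (β⁻¹ • X : Ω →ₘ[P] ℝ) ω) P := by
    obtain ⟨C, hC⟩ := hZ
    exact ((hX.bdd_mul Z.aestronglyMeasurable hC).const_mul β⁻¹).congr hae.symm
  rw [← ofReal_integral_eq_lintegral_ofReal hint hpos, integral_congr_ae hae, integral_const_mul,
    show ∫ ω, Z ω * X ω ∂P = l Z' from (hl Z' hZ).symm]
  have h1 : l Z' ≤ β * ‖Z'‖ :=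
    (le_abs_self _).trans ((l.le_opNorm Z').trans (by gcongr))
  -- The choice `k = 1` in the Amemiya norm gives `‖Z‖ ≤ 1 + I(Z)`; the `1` here is the bound
  -- obtained for `J`.
  have h2 : ‖Z'‖ ≤ (1 + (A.modI Z).toReal) / 1 :=
    A.modI.norm_ame_le Z'.1 one_pos ENNReal.toReal_nonneg (by
      rw [ENNReal.ofReal_toReal hI, one_smul]
      exact le_rfl)
  calc ENNReal.ofReal (β⁻¹ * l Z') ≤ ENNReal.ofReal (1 + (A.modI Z).toReal) := by
        refine ENNReal.ofReal_le_ofReal ?_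
        rw [inv_mul_le_iff₀ hβ]
        rw [div_one] at h2
        exact h1.trans (by gcongr)
    _ = 1 + A.modI Z := by
        rw [ENNReal.ofReal_add zero_le_one ENNReal.toReal_nonneg, ENNReal.ofReal_one,
          ENNReal.ofReal_toReal hI]

/-- The constant `1` is a finite element, and pairing with it returns `X`. -/
lemma integrable_of_lux (X : A.modJ.Lux) : Integrable X.val P := by
  refine (A.integrable_mul (A.indicatorElement MeasurableSet.univ).1.mem X.mem).congr ?_
  filter_upwards [A.coeFn_indicatorElement (P := P) MeasurableSet.univ] with ω h
  rw [h, Set.indicator_univ, Pi.one_apply, one_mul]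

/-- The isometric embedding of `L_J` into the dual of `E_I`. -/
def dualIsometry : A.modJ.Lux →ₗᵢ[ℝ] StrongDual ℝ A.modI.finiteElements where
  toFun X := (A.dualOfLux X).comp A.modI.finiteElements.subtypeL
  map_add' X X' := by
    ext Z
    exact LinearMap.congr_fun (map_add A.pairing X X') Z.1
  map_smul' c X := by
    ext Z
    exact LinearMap.congr_fun (map_smul A.pairing c X) Z.1
  norm_map' X := by
    refine le_antisymm (ContinuousLinearMap.opNorm_le_bound _ (norm_nonneg _) fun Z =>
      A.abs_integral_mul_le_norm Z.1 X) (le_of_forall_gt_imp_ge_of_dense fun β hβ => ?_)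
    have hβ0 : 0 < β := lt_of_le_of_lt (norm_nonneg (E := StrongDual ℝ A.modI.finiteElements) _) hβ
    -- Every `β` above the operator norm is admissible in the infimum defining the Luxemburg norm.
    exact A.modJ.luxemburg_le_of_le_one hβ0 (A.modJ_le_one_of_norm_le (A.integrable_of_lux X)
      (fun _ _ => rfl) hβ0 hβ.le)

lemma dualIsometry_apply (X : A.modJ.Lux) (Z : A.modI.finiteElements) :
    A.dualIsometry X Z = ∫ ω, Z.1.val ω * X.val ω ∂P := rfl

/-- The Radon–Nikodym density of `l` lies in `L_J` by the bound on `J`; it then defines a continuous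
functional which agrees with `l` on the dense simple functions. -/
lemma dualIsometry_surjective : Function.Surjective A.dualIsometry := by
  intro l
  obtain ⟨X, hXi, hX⟩ := A.exists_integrable_density l
  -- Adding `1` keeps the scale positive when `l = 0`.
  have hβ : 0 < ‖l‖ + 1 := by positivity
  have hJ := A.modJ_le_one_of_norm_le hXi (A.apply_eq_integral_of_bounded hXi hX) hβ (by linarith)
  have hmem : X ∈ A.modJ.space :=
    ⟨(‖l‖ + 1)⁻¹, inv_pos.2 hβ, hJ.trans_lt ENNReal.one_lt_top⟩
  obtain ⟨X', rfl⟩ : ∃ X' : A.modJ.Lux, X'.val = X := ⟨(⟨X, hmem⟩ : A.modJ.space), rfl⟩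
  refine ⟨X', ContinuousLinearMap.ext fun Z => ?_⟩
  obtain ⟨s, -, -, hs⟩ := A.exists_simple_tendsto Z
  refine tendsto_nhds_unique
    ((ContinuousLinearMap.continuous (A.dualIsometry _)).tendsto Z |>.comp hs)
    (((l.continuous.tendsto Z).comp hs).congr fun n => ?_)
  simp only [Function.comp_apply]
  rw [hX, dualIsometry_apply]
  refine integral_congr_ae ?_
  filter_upwards [A.coeFn_ofSimple (s n)] with ω h
  rw [h]

/-- If all elements of `L_I` are finite, the conjugate of `J` is `I`. -/
lemma conjLux_dualOfAme (h : A.modI.finiteElements = ⊤) (Z : A.modI.Ame) :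
    A.modJ.conjLux (A.dualOfAme Z) = (A.modI Z.val : EReal) := by
  refine le_antisymm (iSup_le fun X => EReal.coe_sub_coe_ennreal_le fun hJ hI =>
    (A.integral_mul_le Z X hI hJ).trans_eq (add_comm _ _)) ?_
  have hfin : ∀ W : A.modI.Ame, A.modI W.val ≠ ∞ := fun W => by
    have hW : W ∈ A.modI.finiteElements := h ▸ Submodule.mem_top
    simpa using (hW 1 one_pos).ne
  obtain ⟨l, hl⟩ := A.modI.exists_subgradient h Z
  obtain ⟨X, hX⟩ := A.dualIsometry_surjective (l.comp A.modI.finiteElements.subtypeL)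
  have hlX : A.dualOfLux X = l := by
    ext W
    have hW : W ∈ A.modI.finiteElements := h ▸ Submodule.mem_top
    exact DFunLike.congr_fun hX ⟨W, hW⟩
  -- The subgradient inequality says that `l(W) - I(W)` is largest at `W = Z`, and its supremum is
  -- `I*(l) = J(X)`. Rearranged, `I(Z) ≤ l(Z) - J(X)`, so this `X` attains the conjugate of `J`.
  have hJ : (A.modJ X.val : EReal) ≤ ((l Z - (A.modI Z.val).toReal : ℝ) : EReal) := by
    rw [← A.conjAme_dualOfLux X, hlX]
    refine iSup_le fun W => ?_
    rw [← EReal.coe_ennreal_toReal (hfin W), ← EReal.coe_sub, EReal.coe_le_coe_iff]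
    have := hl W
    rw [map_sub] at this
    linarith
  have hJtop : A.modJ X.val ≠ ∞ := fun hcon => by
    rw [hcon, EReal.coe_ennreal_top, top_le_iff] at hJ
    exact EReal.coe_ne_top _ hJ
  refine le_trans ?_ (le_iSup (fun X : A.modJ.Lux =>
    ((A.dualOfAme Z X : ℝ) : EReal) - (A.modJ X.val : EReal)) X)
  rw [show A.dualOfAme Z X = l Z by rw [← hlX]; rfl]
  rw [← EReal.coe_ennreal_toReal hJtop, EReal.coe_le_coe_iff] at hJ
  rw [← EReal.coe_ennreal_toReal hJtop, ← EReal.coe_ennreal_toReal (hfin Z), ← EReal.coe_sub,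
    EReal.coe_le_coe_iff]
  linarith

end MarketSetting
end

theorem proposition4p8 {Ω : Type*} [MeasurableSpace Ω] (P : Measure Ω) [IsProbabilityMeasure P]
    (A : MarketSetting P) :
    (∃ Φ : A.modJ.Lux ≃ₗᵢ[ℝ] StrongDual ℝ A.modI.finiteElements,
      ∀ (X : A.modJ.Lux) (Z : A.modI.finiteElements),
        Integrable (fun ω => Z.1.val ω * X.val ω) P ∧ Φ X Z = ∫ ω, Z.1.val ω * X.val ω ∂P) ∧
    (∀ X : A.modJ.Lux, ∃ l : StrongDual ℝ A.modI.Ame,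
      (∀ Z : A.modI.Ame,
        Integrable (fun ω => Z.val ω * X.val ω) P ∧ l Z = ∫ ω, Z.val ω * X.val ω ∂P) ∧
      A.modI.conjAme l = (A.modJ X.val : EReal)) ∧
    (A.modI.finiteElements = ⊤ → ∀ Z : A.modI.Ame, ∃ l : StrongDual ℝ A.modJ.Lux,
      (∀ X : A.modJ.Lux,
        Integrable (fun ω => Z.val ω * X.val ω) P ∧ l X = ∫ ω, Z.val ω * X.val ω ∂P) ∧
      A.modJ.conjLux l = (A.modI Z.val : EReal)) := by
  refine ⟨⟨LinearIsometryEquiv.ofSurjective A.dualIsometry A.dualIsometry_surjective,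
    fun X Z => ⟨A.integrable_mul Z.1.mem X.mem, rfl⟩⟩, fun X => ⟨A.dualOfLux X,
    fun Z => ⟨A.integrable_mul Z.mem X.mem, rfl⟩, A.conjAme_dualOfLux X⟩, fun h Z =>
    ⟨A.dualOfAme Z, fun X => ⟨A.integrable_mul Z.mem X.mem, rfl⟩, A.conjLux_dualOfAme h Z⟩⟩
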